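/- **Setting.** Let $A$ be a unital Banach $*$-algebra over $\mathbb C$, and let $\mathcal N\subset B(\mathcal H)$ be a von Neumann algebra with a faithful semi-finite normal trace $\tau$. An operator $T\in\mathcal N$ is *$p$-summable* if $\|T\|_p=\tau(|T|^p)^{1/p}<\infty$, and *$\tau$-compact* if $\mu_x(T)\to0$ as $x\to\infty$, where $\mu_x(T)=\inf\{\|TE\| : E\in\mathcal N \text{ a projection},\ \tau(1-E)\le x\}$. An *odd Breuer–Fredholm module* $(\rho,\mathcal N,F)$ over $A$ consists of a continuous unital $*$-representation $\rho:A\to\mathcal N$ and an operator $F\in\mathcal N$ with $F^2=1$ such that $[F,\rho(a)]$ is $\tau$-compact for all $a\in A$. It is *even* if in addition there is a grading $\chi\in\mathcal N$, $\chi=\chi^*$, $\chi^2=1$, which commutes with all $\rho(a)$ and anticommutes with $F$; in the odd case put $\chi=1$. For $0<p<\infty$ the module is *$p$-summable* if $[F,\rho(a)]$ is $p$-summable for every $a\in A$. Below $a$ stands for $\rho(a)$. Let $C^k(A)$ be the space of continuous linear functionals on $A\hat\otimes(A/\mathbb C)^{\hat\otimes k}$ (projective tensor product), i.e. of continuous $(k+1)$-linear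 functionals on $A$ that vanish when one of the last $k$ arguments is $1$, with norm $\|\phi_k\|=\sup\{|\phi_k(a_0,\dots,a_k)|:\|a_j\|\le1\}$. A family $\phi=(\phi_k)_{k\ge0}$, $\phi_k\in C^k(A)$, is an *entire cochain* if $\sum_k\Gamma(\tfrac k2)\|\phi_k\|z^k$ is an entire function of $z$ (the term $k=0$ being irrelevant). It is *even* (*odd*) if $\phi_k=0$ for all odd (even) $k$. Put $$(b\phi)(a_0,\dots,a_k)=\sum_{j=0}^{k-1}(-1)^j\phi_{k-1}(a_0,\dots,a_ja_{j+1},\dots,a_k)+(-1)^k\phi_{k-1}(a_ka_0,a_1,\dots,a_{k-1}),$$ $$(B\phi)(a_0,\dots,a_k)=\sum_{j=0}^{k}(-1)^{kj}\phi_{k+1}(1,a_j,\dots,a_k,a_0,\dots,a_{j-1}),$$ with $b\phi=0$ in degree $0$. *Entire cyclic cocycles* are the entire cochains $\phi$ with $(b+B)\phi=0$, and $\mathrm{HE}^{+}(A)$ (resp. $\mathrm{HE}^-(A)$) is the quotient of the even (resp. odd) entire cyclic cocycles by those of the form $(b+B)\theta$ with $\theta$ an odd (resp. even) entire cochain. **Theorem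 1.3 (Connes character is a cocycle).** Let $0<p<\infty$, and let $(\rho,\mathcal N,F)$ be an even (resp. odd) $p$-summable Breuer–Fredholm module over $A$. For every even (resp. odd) integer $n>p$ the operators $\chi F[F,a_0]\cdots[F,a_n]$ and $\chi a_0F[F,a_1]\cdots[F,a_{n+1}]$ are trace class for all $a_j\in A$. Let $\mathtt{ch}^n(F)$ and $\psi^{n+1}(F)$ be the families concentrated in degree $n$ and $n+1$, respectively, given there by $$\mathtt{ch}^n(F)(a_0,\dots,a_n)=\frac{\Gamma(\frac n2+1)}{2\cdot n!}\,\tau\bigl(\chi F[F,a_0]\cdots[F,a_n]\bigr),$$ $$\psi^{n+1}(F)(a_0,\dots,a_{n+1})=\frac{\Gamma(\frac n2+2)}{(n+2)!}\,\tau\bigl(\chi a_0F[F,a_1]\cdots[F,a_{n+1}]\bigr).$$ Then: 1. $\mathtt{ch}^n(F)$ is an entire cyclic cocycle, even (resp. odd), for every even (resp. odd) $n>p$, and its class in $\mathrm{HE}^+(A)$ (resp. $\mathrm{HE}^-(A)$) is the same for all such $n$; 2. for every such $n$, $\psi^{n+1}(F)$ is an odd (resp. even) entire cochain and $\mathtt{ch}^n(F)-\mathtt{ch}^{n+2}(F)=(b+B)\psi^{n+1}(F)$.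 -/

import Mathlib

open Filter Topology
open scoped ENNReal NNReal ComplexStarModule

noncomputable section

namespace BreuerFredholm

/-! ### Semi-finite von Neumann algebras -/

section VonNeumann

variable {H : Type*} [NormedAddCommGroup H] [InnerProductSpace ℂ H] [CompleteSpace H]

/-- The σ-weak (ultraweak) topology on the bounded operators of `H`: the coarsest topology for which
all functionals `T ↦ ∑ᵢ ⟨xᵢ, T yᵢ⟩` with `∑ᵢ ‖xᵢ‖² < ∞` and `∑ᵢ ‖yᵢ‖² < ∞` are continuous. -/
abbrev sigmaWeakTopology (H : Type*) [NormedAddCommGroup H] [InnerProductSpace ℂ H] :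
    TopologicalSpace (H →L[ℂ] H) :=
  ⨅ (x : lp (fun _ : ℕ => H) 2) (y : lp (fun _ : ℕ => H) 2),
    TopologicalSpace.induced (fun T : H →L[ℂ] H => ∑' i : ℕ, inner ℂ (x i) (T (y i)))
      inferInstance

/-- A faithful semi-finite normal trace on the von Neumann algebra `N ⊆ B(H)`, as an additive and
positively homogeneous map `τ : N₊ → [0, ∞]`. For convenience `τ` is a function on all operators of
`H`, but only its values on the positive operators in `N` carry any meaning. The order on operators
is the Loewner order. -/
structure SemifiniteTrace (N : VonNeumannAlgebra H) where
  /-- The weight itself. -/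
  toFun : (H →L[ℂ] H) → ℝ≥0∞
  map_add : ∀ x ∈ N, ∀ y ∈ N, 0 ≤ x → 0 ≤ y → toFun (x + y) = toFun x + toFun y
  map_smul : ∀ (c : ℝ≥0), ∀ x ∈ N, 0 ≤ x → toFun (((c : ℝ) : ℂ) • x) = c * toFun x
  tracial : ∀ x ∈ N, toFun (star x * x) = toFun (x * star x)
  faithful : ∀ x ∈ N, 0 ≤ x → toFun x = 0 → x = 0
  /-- `τ` preserves suprema of bounded increasing nets of positive operators. -/
  normal : ∀ S : Set (H →L[ℂ] H), S.Nonempty → DirectedOn (· ≤ ·) S →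
    (∀ s ∈ S, s ∈ N ∧ 0 ≤ s) → ∀ x ∈ N, IsLUB S x → toFun x = ⨆ s ∈ S, toFun s
  /-- The (non-unital) `*`-algebra generated by the positive elements of finite trace is
  σ-weakly dense in `N`. -/
  semifinite : ∀ x ∈ N, x ∈ @closure _ (sigmaWeakTopology H)
    (NonUnitalStarAlgebra.adjoin ℂ {y : H →L[ℂ] H | y ∈ N ∧ 0 ≤ y ∧ toFun y < ∞} :
      Set (H →L[ℂ] H))

namespace SemifiniteTrace

variable {N : VonNeumannAlgebra H} (τ : SemifiniteTrace N)

/-- The `p`-norm `‖T‖_p = τ(|T|^p)^{1/p} ∈ [0, ∞]`. -/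
def pNorm (p : ℝ) (T : H →L[ℂ] H) : ℝ≥0∞ :=
  τ.toFun ((CFC.abs T) ^ p) ^ (1 / p)

/-- `T ∈ 𝓛^p_N`: the operator `T` lies in `N` and is `p`-summable. -/
def IsSummable (p : ℝ) (T : H →L[ℂ] H) : Prop :=
  T ∈ N ∧ τ.pNorm p T < ∞

/-- The generalized singular number
`μ_x(T) = inf {‖T E‖ : E a projection in N with τ(1 - E) ≤ x}`. -/
def singularNumber (x : ℝ) (T : H →L[ℂ] H) : ℝ :=
  sInf {r : ℝ | ∃ E ∈ N, IsStarProjection E ∧ τ.toFun (1 - E) ≤ ENNReal.ofReal x ∧ r = ‖T * E‖}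

/-- `T ∈ 𝓚_N`: the operator `T` lies in `N` and is `τ`-compact. -/
def IsTauCompact (T : H →L[ℂ] H) : Prop :=
  T ∈ N ∧ Tendsto (fun x : ℝ => τ.singularNumber x T) atTop (𝓝 0)

/-- The linear extension of the trace to the trace class operators `𝓛¹_N`: writing
`T = (R₊ - R₋) + i (J₊ - J₋)` with the positive and negative parts of the real and the imaginary
part of `T`, one has `τ(T) = (τ(R₊) - τ(R₋)) + i (τ(J₊) - τ(J₋))`.
It is meaningful for `τ.IsSummable 1 T`. -/
def trace (T : H →L[ℂ] H) : ℂ :=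
  ((((τ.toFun ((ℜ T : H →L[ℂ] H)⁺)).toReal - (τ.toFun ((ℜ T : H →L[ℂ] H)⁻)).toReal : ℝ)) : ℂ) +
    Complex.I *
      (((τ.toFun ((ℑ T : H →L[ℂ] H)⁺)).toReal - (τ.toFun ((ℑ T : H →L[ℂ] H)⁻)).toReal : ℝ) : ℂ)

end SemifiniteTrace

end VonNeumann

/-! ### Entire cyclic cohomology of a unital Banach algebra -/

section Entire

variable (A : Type*) [NormedRing A] [NormedAlgebra ℂ A]

/-- Families `(φ_k)_k` of functions of `k + 1` variables in `A`. The cochains are singled out by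
`IsCochain` below. -/
abbrev Family : Type _ := (k : ℕ) → (Fin (k + 1) → A) → ℂ

variable {A}

/-- `φ` is a cochain of degree `k`, i.e. a continuous linear functional on the projective tensor
product `A ⊗̂ (A/ℂ)^{⊗̂ k}`; by the universal property of that product, this is a continuous
multilinear functional of `k + 1` variables in `A` that vanishes as soon as one of the variables
`a₁, …, a_k` is the unit. -/
def IsCochain (k : ℕ) (φ : (Fin (k + 1) → A) → ℂ) : Prop :=
  (∃ f : ContinuousMultilinearMap ℂ (fun _ : Fin (k + 1) => A) ℂ, ∀ a, f a = φ a) ∧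
    ∀ a : Fin (k + 1) → A, ∀ i, i ≠ 0 → a i = 1 → φ a = 0

/-- The norm `sup {|φ(a₀, …, a_k)| : ‖a_j‖ ≤ 1 for all j}`. -/
def cochainNorm {k : ℕ} (φ : (Fin (k + 1) → A) → ℂ) : ℝ :=
  sSup {r : ℝ | ∃ a : Fin (k + 1) → A, (∀ j, ‖a j‖ ≤ 1) ∧ r = ‖φ a‖}

/-- The growth condition: `∑_k Γ(k/2) ‖φ_k‖ z^k` is an entire function of `z`. (At `k = 0` Mathlib
has `Γ(0) = 0`; the constant term does not matter here.) -/
def EntireGrowth (φ : Family A) : Prop :=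
  ∀ z : ℂ, Summable fun k : ℕ =>
    ((Real.Gamma ((k : ℝ) / 2) * cochainNorm (φ k) : ℝ) : ℂ) * z ^ k

theorem IsCochain.zero (k : ℕ) : IsCochain k (0 : (Fin (k + 1) → A) → ℂ) :=
  ⟨⟨0, fun _ => rfl⟩, fun _ _ _ _ => rfl⟩

theorem IsCochain.add {k : ℕ} {φ ψ : (Fin (k + 1) → A) → ℂ} (hφ : IsCochain k φ)
    (hψ : IsCochain k ψ) : IsCochain k (φ + ψ) := by
  obtain ⟨⟨f, hf⟩, hf1⟩ := hφ
  obtain ⟨⟨g, hg⟩, hg1⟩ := hψ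
  refine ⟨⟨f + g, fun a => by simp [hf, hg]⟩, fun a i hi h => ?_⟩
  simp [hf1 a i hi h, hg1 a i hi h]

theorem IsCochain.smul {k : ℕ} {φ : (Fin (k + 1) → A) → ℂ} (c : ℂ) (hφ : IsCochain k φ) :
    IsCochain k (c • φ) := by
  obtain ⟨⟨f, hf⟩, hf1⟩ := hφ
  refine ⟨⟨c • f, fun a => by simp [hf]⟩, fun a i hi h => ?_⟩
  simp [hf1 a i hi h]

theorem cochainNorm_nonneg {k : ℕ} (φ : (Fin (k + 1) → A) → ℂ) : 0 ≤ cochainNorm φ := by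
  apply Real.sSup_nonneg
  rintro r ⟨a, -, rfl⟩
  exact norm_nonneg _

theorem cochainNorm_zero (k : ℕ) : cochainNorm (0 : (Fin (k + 1) → A) → ℂ) = 0 := by
  refine le_antisymm (Real.sSup_le ?_ le_rfl) (cochainNorm_nonneg _)
  rintro r ⟨a, -, rfl⟩
  simp

theorem IsCochain.le_cochainNorm {k : ℕ} {φ : (Fin (k + 1) → A) → ℂ} (hφ : IsCochain k φ)
    {a : Fin (k + 1) → A} (ha : ∀ j, ‖a j‖ ≤ 1) : ‖φ a‖ ≤ cochainNorm φ := by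
  obtain ⟨⟨f, hf⟩, -⟩ := hφ
  refine le_csSup ⟨‖f‖, ?_⟩ ⟨a, ha, rfl⟩
  rintro r ⟨a, ha, rfl⟩
  rw [← hf a]
  refine (f.le_opNorm a).trans (mul_le_of_le_one_right (norm_nonneg _) ?_)
  exact Finset.prod_le_one (fun _ _ => norm_nonneg _) fun i _ => ha i

theorem cochainNorm_add_le {k : ℕ} {φ ψ : (Fin (k + 1) → A) → ℂ} (hφ : IsCochain k φ)
    (hψ : IsCochain k ψ) : cochainNorm (φ + ψ) ≤ cochainNorm φ + cochainNorm ψ := by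
  refine Real.sSup_le ?_ (add_nonneg (cochainNorm_nonneg _) (cochainNorm_nonneg _))
  rintro r ⟨a, ha, rfl⟩
  exact (norm_add_le _ _).trans (add_le_add (hφ.le_cochainNorm ha) (hψ.le_cochainNorm ha))

theorem cochainNorm_smul_le {k : ℕ} {φ : (Fin (k + 1) → A) → ℂ} (c : ℂ) (hφ : IsCochain k φ) :
    cochainNorm (c • φ) ≤ ‖c‖ * cochainNorm φ := by
  refine Real.sSup_le ?_ (mul_nonneg (norm_nonneg _) (cochainNorm_nonneg _))
  rintro r ⟨a, ha, rfl⟩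
  rw [Pi.smul_apply, norm_smul]
  exact mul_le_mul_of_nonneg_left (hφ.le_cochainNorm ha) (norm_nonneg _)

theorem norm_growthTerm (φ : Family A) (z : ℂ) (k : ℕ) :
    ‖((Real.Gamma ((k : ℝ) / 2) * cochainNorm (φ k) : ℝ) : ℂ) * z ^ k‖ =
      Real.Gamma ((k : ℝ) / 2) * cochainNorm (φ k) * ‖z‖ ^ k := by
  rw [norm_mul, norm_pow, Complex.norm_real, Real.norm_of_nonneg]
  exact mul_nonneg (Real.Gamma_nonneg_of_nonneg (by positivity)) (cochainNorm_nonneg _)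

theorem EntireGrowth.add {φ ψ : Family A} (hφ : ∀ k, IsCochain k (φ k))
    (hψ : ∀ k, IsCochain k (ψ k)) (eφ : EntireGrowth φ) (eψ : EntireGrowth ψ) :
    EntireGrowth (φ + ψ) := by
  intro z
  refine Summable.of_norm_bounded ((eφ z).norm.add (eψ z).norm) fun k => ?_
  rw [norm_growthTerm, norm_growthTerm, norm_growthTerm, ← add_mul, ← mul_add]
  have hG : 0 ≤ Real.Gamma ((k : ℝ) / 2) := Real.Gamma_nonneg_of_nonneg (by positivity)
  exact mul_le_mul_of_nonneg_right
    (mul_le_mul_of_nonneg_left (cochainNorm_add_le (hφ k) (hψ k)) hG) (by positivity)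

theorem EntireGrowth.smul {φ : Family A} (c : ℂ) (hφ : ∀ k, IsCochain k (φ k))
    (eφ : EntireGrowth φ) : EntireGrowth (c • φ) := by
  intro z
  refine Summable.of_norm_bounded ((eφ z).norm.mul_left ‖c‖) fun k => ?_
  rw [norm_growthTerm, norm_growthTerm]
  have hG : 0 ≤ Real.Gamma ((k : ℝ) / 2) := Real.Gamma_nonneg_of_nonneg (by positivity)
  calc _ ≤ Real.Gamma ((k : ℝ) / 2) * (‖c‖ * cochainNorm (φ k)) * ‖z‖ ^ k :=
        mul_le_mul_of_nonneg_right
          (mul_le_mul_of_nonneg_left (cochainNorm_smul_le c (hφ k)) hG) (by positivity)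
    _ = _ := by ring

variable (A)

/-- The space `C^ε_ω(A)` of entire cochains of parity `ε`: `ε = 0` gives the even entire cochains
`C^+_ω(A)` and `ε = 1` the odd ones `C^-_ω(A)`. -/
def entireCochains (ε : ZMod 2) : Submodule ℂ (Family A) where
  carrier := {φ | (∀ k, IsCochain k (φ k)) ∧ EntireGrowth φ ∧
    ∀ k : ℕ, (k : ZMod 2) ≠ ε → φ k = 0}
  zero_mem' := ⟨fun k => IsCochain.zero k, fun z => by
      simp [cochainNorm_zero, summable_zero],
    fun _ _ => rfl⟩
  add_mem' := by
    rintro φ ψ ⟨h1, h2, h3⟩ ⟨h1', h2', h3'⟩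
    exact ⟨fun k => (h1 k).add (h1' k), EntireGrowth.add h1 h1' h2 h2',
      fun k hk => by simp [h3 k hk, h3' k hk]⟩
  smul_mem' := by
    rintro c φ ⟨h1, h2, h3⟩
    exact ⟨fun k => (h1 k).smul c, EntireGrowth.smul c h1 h2, fun k hk => by simp [h3 k hk]⟩

variable {A}

/-- The transpose of the Hochschild boundary: `(bφ)(a₀, …, a_k)` is
`∑_{j<k} (-1)^j φ_{k-1}(a₀, …, a_j a_{j+1}, …, a_k) + (-1)^k φ_{k-1}(a_k a₀, a₁, …, a_{k-1})`. -/
def hochschild (φ : Family A) : Family A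
  | 0 => 0
  | k + 1 => fun a =>
      (∑ j : Fin (k + 1), (-1 : ℂ) ^ (j : ℕ) * φ k (Fin.contractNth j.castSucc (· * ·) a)) +
        (-1 : ℂ) ^ (k + 1) *
          φ k (Function.update (Fin.init a) 0 (a (Fin.last (k + 1)) * a 0))

/-- The transpose of Connes' boundary: `(Bφ)(a₀, …, a_k)` is
`∑_{j≤k} (-1)^{kj} φ_{k+1}(1, a_j, …, a_k, a₀, …, a_{j-1})`. The addition in the index is modulo
`k + 1`. -/
def connesB (φ : Family A) : Family A := fun k a =>
  ∑ j : Fin (k + 1), (-1 : ℂ) ^ (k * (j : ℕ)) *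
    φ (k + 1) (Fin.cons (1 : A) (fun i : Fin (k + 1) => a (i + j)))

variable (A)

/-- The total coboundary `b + B`. -/
def bB : Family A →ₗ[ℂ] Family A where
  toFun φ := hochschild φ + connesB φ
  map_add' φ ψ := by
    funext k a
    cases k <;>
      simp only [hochschild, connesB, Pi.add_apply, Pi.zero_apply, mul_add,
        Finset.sum_add_distrib] <;> ring
  map_smul' c φ := by
    funext k a
    cases k <;>
      simp only [hochschild, connesB, Pi.add_apply, Pi.zero_apply, Pi.smul_apply, smul_eq_mul,
        RingHom.id_apply, mul_add, Finset.mul_sum, mul_left_comm c, mul_zero]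

/-- The entire cyclic cocycles of parity `ε`. -/
def entireCocycles (ε : ZMod 2) : Submodule ℂ (Family A) :=
  entireCochains A ε ⊓ LinearMap.ker (bB A)

/-- The coboundaries `(b + B) θ` of the entire cochains `θ` of the opposite parity. -/
def entireCoboundaries (ε : ZMod 2) : Submodule ℂ (Family A) :=
  (entireCochains A (ε + 1)).map (bB A)

/-- Entire cyclic cohomology: `HE A 0` is `HE^+(A)` and `HE A 1` is `HE^-(A)`. -/
abbrev HE (ε : ZMod 2) : Type _ :=
  ↥(entireCocycles A ε) ⧸ (entireCoboundaries A ε).comap (entireCocycles A ε).subtype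

variable {A}

/-- The class in entire cyclic cohomology of an entire cyclic cocycle. -/
def HE.mk {ε : ZMod 2} (φ : Family A) (hφ : φ ∈ entireCocycles A ε) : HE A ε :=
  Submodule.Quotient.mk ⟨φ, hφ⟩

end Entire

/-! ### Breuer–Fredholm modules and the Connes character -/

section Modules

/-- An (odd) Breuer–Fredholm module `(ρ, N, F)` over the unital Banach `*`-algebra `A`, where `N` is
a von Neumann algebra on `H` with a faithful semi-finite normal trace `τ`. -/
structure OddModule (A : Type*) [NormedRing A] [NormedAlgebra ℂ A] [StarRing A]
    (H : Type*) [NormedAddCommGroup H] [InnerProductSpace ℂ H] [CompleteSpace H] where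
  N : VonNeumannAlgebra H
  τ : SemifiniteTrace N
  /-- The (unital) `*`-representation. -/
  ρ : A →⋆ₐ[ℂ] (H →L[ℂ] H)
  ρ_mem : ∀ a, ρ a ∈ N
  ρ_continuous : Continuous ρ
  F : H →L[ℂ] H
  F_mem : F ∈ N
  F_sq : F * F = 1
  comm_compact : ∀ a, τ.IsTauCompact (F * ρ a - ρ a * F)

/-- An even Breuer–Fredholm module: in addition there is a grading `χ ∈ N` for which all `ρ(a)` are
even and `F` is odd. -/
structure EvenModule (A : Type*) [NormedRing A] [NormedAlgebra ℂ A] [StarRing A]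
    (H : Type*) [NormedAddCommGroup H] [InnerProductSpace ℂ H] [CompleteSpace H] extends
    OddModule A H where
  χ : H →L[ℂ] H
  χ_mem : χ ∈ N
  χ_selfAdjoint : IsSelfAdjoint χ
  χ_sq : χ * χ = 1
  χ_even : ∀ a, χ * ρ a = ρ a * χ
  χ_odd : χ * F = -(F * χ)

variable {A : Type*} [NormedRing A] [NormedAlgebra ℂ A] [StarRing A]
  {H : Type*} [NormedAddCommGroup H] [InnerProductSpace ℂ H] [CompleteSpace H]

namespace OddModule

variable (M : OddModule A H)

/-- The commutator `[F, ρ(a)]`. -/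
def comm (a : A) : H →L[ℂ] H := M.F * M.ρ a - M.ρ a * M.F

/-- The product `[F, ρ(a₀)] [F, ρ(a₁)] ⋯ [F, ρ(a_{k-1})]`, in this order. -/
def commProd {k : ℕ} (a : Fin k → A) : H →L[ℂ] H := (List.ofFn fun i => M.comm (a i)).prod

/-- The module is `p`-summable. -/
def IsPSummable (p : ℝ) : Prop := ∀ a, M.τ.IsSummable p (M.comm a)

/-- The operator `γ F [F, a₀] ⋯ [F, a_n]`. Here `γ` will be the grading in the even case and `1` in
the odd case. -/
def chOp (γ : H →L[ℂ] H) {n : ℕ} (a : Fin (n + 1) → A) : H →L[ℂ] H :=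
  γ * M.F * M.commProd a

/-- The operator `γ a₀ F [F, a₁] ⋯ [F, a_{n+1}]`. -/
def psiOp (γ : H →L[ℂ] H) {n : ℕ} (a : Fin (n + 2) → A) : H →L[ℂ] H :=
  γ * M.ρ (a 0) * M.F * M.commProd (Fin.tail a)

/-- The family concentrated in degree `n` with
`(a₀, …, a_n) ↦ Γ(n/2 + 1) / (2 n!) · τ(γ F [F, a₀] ⋯ [F, a_n])`. -/
def chWith (γ : H →L[ℂ] H) (n : ℕ) : Family A :=
  Pi.single n fun a =>
    ((Real.Gamma ((n : ℝ) / 2 + 1) / (2 * (n.factorial : ℝ)) : ℝ) : ℂ) * M.τ.trace (M.chOp γ a)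

/-- The family concentrated in degree `n + 1` with
`(a₀, …, a_{n+1}) ↦ Γ(n/2 + 2) / (n + 2)! · τ(γ a₀ F [F, a₁] ⋯ [F, a_{n+1}])`. -/
def psiWith (γ : H →L[ℂ] H) (n : ℕ) : Family A :=
  Pi.single (n + 1) fun a =>
    ((Real.Gamma ((n : ℝ) / 2 + 2) / ((n + 2).factorial : ℝ) : ℝ) : ℂ) *
      M.τ.trace (M.psiOp γ a)

/-- The odd Connes character `ch^n(F)` (for odd `n`). -/
def ch (n : ℕ) : Family A := M.chWith 1 n

/-- The transgression cochain `ψ^{n+1}(F)` (for odd `n`). -/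
def psi (n : ℕ) : Family A := M.psiWith 1 n

end OddModule

namespace EvenModule

variable (M : EvenModule A H)

/-- The even Connes character `ch^n(F)` (for even `n`). -/
def ch (n : ℕ) : Family A := M.toOddModule.chWith M.χ n

/-- The transgression cochain `ψ^{n+1}(F)` (for even `n`). -/
def psi (n : ℕ) : Family A := M.toOddModule.psiWith M.χ n

end EvenModule

end Modules

end BreuerFredholm

end

/-! ### Functional calculus inside `N` and inequalities for the weight `τ`. -/

noncomputable section

namespace BreuerFredholm

variable {H : Type*} [NormedAddCommGroup H] [InnerProductSpace ℂ H] [CompleteSpace H]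

/-! The algebra is short. As `F² = 1`, `F` anticommutes with every `[F, a]`, so with `γ` the grading
(or `1`) the functional `X ↦ τ(γ F X)` is cyclic up to the sign `(-1)^n` when a commutator is moved
around. The Leibniz rule makes alternating sums of contracted commutator products telescope to their
two ends. Hence `B ch^n = 0` because `[F, 1] = 0`; `b ch^n = 0` because the ends cancel against the
wrap-around term, up to the trace of an operator that is odd under conjugation by `F`; `B ψ^{n+1} =
ch^n` because all `n + 1` rotations contribute equally; and `b ψ^{n+1} = -ch^{n+2}` because `τ(γ F
[F, a₀] X) = 2 τ(γ a₀ X)`. Characters two degrees apart are therefore cohomologous.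

The analysis has to provide three things: products of more than `p` commutators are trace class, the
trace is linear and cyclic on such operators, and the cochains are continuous. Polar decomposition,
Hölder's inequality and `p`-norm triangle inequalities are all avoided.

Trace class is expressed by domination (`TraceBound`): the form of `T` is controlled by two positive
operators `A`, `B` of finite trace. This passes easily to sums, two-sided products and convergent
series, and it bounds `τ(|T|)` (`TraceBound.abs_le`) and the linear trace
(`TraceBound.norm_trace_le`). The key inequality for the weight is `posPart_le`: `R ≤ x` and `0 ≤ x`
give `τ(R⁺) ≤ τ(x)`.

Hölder is replaced by dyadic truncation (`IsApprox`). If `τ(|T|^p)` is finite, cutting `|T|` off at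
`M / 2^j` gives operators of norm `O(2^{-j})` whose successive differences have trace bound `O((2^p
/ 2)^j)`. For a product of `k` such operators the differences are `O((2^p / 2^k)^j)`, so the
telescoping series converges as soon as `p < k`. This covers `p < 1` as well.

Continuity follows from Baire: the sets where `τ(|[F, a]|^p) ≤ m` are closed by lower semicontinuity
of `τ` and cover `A`, so the approximations have uniform constants near `0`, and a multilinear map
that is bounded on a small polydisc is continuous. -/

instance (N : VonNeumannAlgebra H) : IsClosed (N : Set (H →L[ℂ] H)) := by
  rw [← N.centralizer_centralizer]
  exact Set.isClosed_centralizer _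

instance : SMulMemClass (VonNeumannAlgebra H) ℂ (H →L[ℂ] H) where
  smul_mem {s} c _ hx := s.toStarSubalgebra.smul_mem hx c

section Membership

variable {N : VonNeumannAlgebra H} {a : H →L[ℂ] H}

theorem cfc_mem_vN (f : ℝ → ℝ) (ha : a ∈ N) : cfc f a ∈ N :=
  cfc_mem (𝕜' := ℂ) f ha

theorem posPart_mem (ha : a ∈ N) : a⁺ ∈ N :=
  cfcₙ_mem (𝕜' := ℂ) (fun x : ℝ => x⁺) ha

theorem negPart_mem (ha : a ∈ N) : a⁻ ∈ N :=
  cfcₙ_mem (𝕜' := ℂ) (fun x : ℝ => x⁻) ha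

theorem sqrt_mem (ha : a ∈ N) : CFC.sqrt a ∈ N := by
  by_cases h : 0 ≤ a
  · rw [CFC.sqrt_eq_real_sqrt a h]
    exact cfcₙ_mem (𝕜' := ℂ) _ ha
  · rw [CFC.sqrt_of_not_nonneg h]
    exact zero_mem N

theorem abs_mem (ha : a ∈ N) : CFC.abs a ∈ N :=
  sqrt_mem (mul_mem (star_mem ha) ha)

theorem realSmul_mem (r : ℝ) (ha : a ∈ N) : r • a ∈ N := by
  rw [← Complex.coe_smul]
  exact SMulMemClass.smul_mem _ ha

theorem realPart_mem (ha : a ∈ N) : (ℜ a : H →L[ℂ] H) ∈ N := by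
  rw [realPart_apply_coe]
  exact realSmul_mem _ (add_mem ha (star_mem ha))

theorem imaginaryPart_mem (ha : a ∈ N) : (ℑ a : H →L[ℂ] H) ∈ N := by
  rw [imaginaryPart_apply_coe]
  exact SMulMemClass.smul_mem _ (realSmul_mem _ (sub_mem ha (star_mem ha)))

end Membership

theorem cfc_sq_mul_self {a : H →L[ℂ] H} (ha : IsSelfAdjoint a) (g : ℝ → ℝ) (hg : Continuous g) :
    cfc g a * a * cfc g a = cfc (fun t => g t * t * g t) a := by
  rw [cfc_mul (fun t => g t * t) g a (by fun_prop) (by fun_prop),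
    cfc_mul g (fun t => t) a (by fun_prop) (by fun_prop), cfc_id' ℝ a]

namespace SemifiniteTrace

variable {N : VonNeumannAlgebra H} (τ : SemifiniteTrace N)

theorem mono {x y : H →L[ℂ] H} (hx : x ∈ N) (hy : y ∈ N) (h0 : 0 ≤ x) (h : x ≤ y) :
    τ.toFun x ≤ τ.toFun y := by
  have := τ.map_add x hx (y - x) (sub_mem hy hx) h0 (sub_nonneg.2 h)
  rw [add_sub_cancel] at this
  rw [this]
  exact le_self_add

theorem map_zero : τ.toFun 0 = 0 := by
  simpa using τ.map_smul 0 0 (zero_mem N) le_rfl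

theorem map_realSmul (c : ℝ≥0) {x : H →L[ℂ] H} (hx : x ∈ N) (h0 : 0 ≤ x) :
    τ.toFun ((c : ℝ) • x) = c * τ.toFun x := by
  rw [← Complex.coe_smul]
  exact τ.map_smul c x hx h0

/-- With `r = √x`, the operator is `(r s*)* (r s*)`; traciality turns it into `r s* s r`, which is
at most `‖s‖² x`. -/
theorem conj_le {x s : H →L[ℂ] H} (hx : x ∈ N) (hs : s ∈ N) (h0 : 0 ≤ x) {c : ℝ≥0}
    (hc : ‖s‖ ≤ c) : τ.toFun (s * x * star s) ≤ (c ^ 2 : ℝ≥0) * τ.toFun x := by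
  set r := CFC.sqrt x with hr
  have hrN : r ∈ N := sqrt_mem hx
  have hrs : star r = r := (IsSelfAdjoint.of_nonneg (CFC.sqrt_nonneg x)).star_eq
  have hrr : r * r = x := CFC.sqrt_mul_sqrt_self x
  have e1 : s * x * star s = star (r * star s) * (r * star s) := by
    simp [hrs, ← hrr, mul_assoc]
  have e2 : (r * star s) * star (r * star s) = star r * (star s * s) * r := by
    simp [hrs, mul_assoc]
  have h1 : star r * (star s * s) * r ≤ ((c ^ 2 : ℝ≥0) : ℝ) • x := by
    refine (CStarAlgebra.star_left_conjugate_le_norm_smul (a := r)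
      (IsSelfAdjoint.star_mul_self s)).trans ?_
    rw [hrs, hrr, CStarRing.norm_star_mul_self]
    refine smul_le_smul_of_nonneg_right ?_ h0
    rw [NNReal.coe_pow, pow_two]
    exact mul_le_mul hc hc (norm_nonneg _) c.2
  rw [e1, τ.tracial _ (mul_mem hrN (star_mem hs)), e2, ← τ.map_realSmul _ hx h0]
  refine τ.mono ?_ (realSmul_mem _ hx) ?_ h1
  · exact mul_mem (mul_mem (star_mem hrN) (mul_mem (star_mem hs) hs)) hrN
  · exact star_left_conjugate_nonneg (star_mul_self_nonneg s) r

/-- The cut-offs `(R - δ)₊` increase to `R⁺` as `δ` decreases to `0`, so normality of `τ` applies.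
-/
theorem posPart_le_of_cutoff {R : H →L[ℂ] H} (hR : R ∈ N) (hsa : IsSelfAdjoint R) {C : ℝ≥0∞}
    (h : ∀ δ : ℝ, 0 < δ → τ.toFun (cfc (fun t : ℝ => max (t - δ) 0) R) ≤ C) :
    τ.toFun R⁺ ≤ C := by
  have hpos : R⁺ = cfc (fun t : ℝ => max t 0) R := by
    rw [CFC.posPart_def, cfcₙ_eq_cfc]; rfl
  have hle : ∀ δ δ' : ℝ, δ ≤ δ' →
      cfc (fun t : ℝ => max (t - δ') 0) R ≤ cfc (fun t : ℝ => max (t - δ) 0) R := by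
    intro δ δ' hδ
    exact cfc_mono (fun t _ => max_le_max (by linarith) le_rfl)
  have hLUB : IsLUB {s | ∃ δ : ℝ, 0 < δ ∧ s = cfc (fun t : ℝ => max (t - δ) 0) R} R⁺ := by
    constructor
    · rintro _ ⟨δ, hδ, rfl⟩
      rw [hpos]
      exact cfc_mono (fun t _ => max_le_max (by linarith) le_rfl)
    · intro b hb
      have h1 : ∀ δ : ℝ, 0 < δ → R⁺ ≤ b + δ • (1 : H →L[ℂ] H) := by
        intro δ hδ
        have h2 : R⁺ ≤ cfc (fun t : ℝ => max (t - δ) 0 + δ) R := by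
          rw [hpos]
          refine cfc_mono (fun t _ => ?_)
          rcases le_total t δ with h | h
          · rw [max_eq_right (by linarith : t - δ ≤ 0)]
            exact max_le (by linarith) (by linarith)
          · rw [max_eq_left (by linarith : 0 ≤ t - δ)]
            exact max_le (by linarith) (by linarith)
        refine h2.trans ?_
        rw [cfc_add_const δ (fun t : ℝ => max (t - δ) 0) R, Algebra.algebraMap_eq_smul_one]
        exact add_le_add (hb ⟨δ, hδ, rfl⟩) le_rfl
      have hlim : Tendsto (fun δ : ℝ => b + δ • (1 : H →L[ℂ] H)) (𝓝[>] 0) (𝓝 b) := by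
        have : Tendsto (fun δ : ℝ => b + δ • (1 : H →L[ℂ] H)) (𝓝 0)
            (𝓝 (b + (0 : ℝ) • (1 : H →L[ℂ] H))) := by
          apply Continuous.tendsto; fun_prop
        simpa using this.mono_left nhdsWithin_le_nhds
      exact ge_of_tendsto hlim (eventually_mem_nhdsWithin.mono fun δ hδ => h1 δ hδ)
  rw [τ.normal {s | ∃ δ : ℝ, 0 < δ ∧ s = cfc (fun t : ℝ => max (t - δ) 0) R}
    ⟨_, 1, one_pos, rfl⟩ ?_ ?_ _ (posPart_mem hR) hLUB]
  · refine iSup₂_le ?_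
    rintro _ ⟨δ, hδ, rfl⟩
    exact h δ hδ
  · rintro _ ⟨δ, hδ, rfl⟩ _ ⟨δ', hδ', rfl⟩
    exact ⟨_, ⟨min δ δ', lt_min hδ hδ', rfl⟩, hle _ _ (min_le_left _ _), hle _ _ (min_le_right _ _)⟩
  · rintro _ ⟨δ, hδ, rfl⟩
    exact ⟨cfc_mem_vN _ hR, cfc_nonneg fun t _ => le_max_right _ _⟩

/-- The operator inequality `R⁺ ≤ x` can fail, but its trace version survives: `(R - δ)₊ = g(R) R
g(R) ≤ g(R) x g(R)` with a contraction `g(R)`, and conjugation by a contraction does not increase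
`τ`. The cut-off `δ > 0` allows `g` to be continuous, whereas `δ = 0` would require a spectral
projection. -/
theorem posPart_le {R x : H →L[ℂ] H} (hR : R ∈ N) (hsa : IsSelfAdjoint R) (hx : x ∈ N)
    (h0 : 0 ≤ x) (h : R ≤ x) : τ.toFun R⁺ ≤ τ.toFun x := by
  refine τ.posPart_le_of_cutoff hR hsa fun δ hδ => ?_
  set g : ℝ → ℝ := fun t => Real.sqrt (max (t - δ) 0 / max t δ) with hg
  have hpos : ∀ t : ℝ, 0 < max t δ := fun t => hδ.trans_le (le_max_right _ _)
  have hgc : Continuous g := by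
    have : ∀ t : ℝ, max t δ ≠ 0 := fun t => (hpos t).ne'
    fun_prop (disch := assumption)
  have hg2 : ∀ t, g t * t * g t = max (t - δ) 0 := by
    intro t
    have : g t * t * g t = (g t * g t) * t := by ring
    rw [this, hg]
    simp only
    rw [Real.mul_self_sqrt (div_nonneg (le_max_right _ _) (hpos t).le)]
    rcases le_total t δ with h | h
    · rw [max_eq_right (by linarith : t - δ ≤ 0)]; simp
    · rw [max_eq_left h, div_mul_cancel₀]; linarith
  have hsg : star (cfc g R) = cfc g R := (cfc_predicate g R : IsSelfAdjoint _).star_eq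
  have hn : ‖cfc g R‖ ≤ (1 : ℝ≥0) := by
    refine norm_cfc_le zero_le_one fun t _ => ?_
    rw [Real.norm_of_nonneg (Real.sqrt_nonneg _)]
    refine Real.sqrt_le_one.2 ((div_le_one (hpos t)).2 ?_)
    exact max_le (by linarith [le_max_left t δ]) (hpos t).le
  have e : cfc (fun t : ℝ => max (t - δ) 0) R = cfc g R * R * star (cfc g R) := by
    rw [hsg, cfc_sq_mul_self hsa g hgc]
    simp only [hg2]
  have hgN := cfc_mem_vN g hR
  calc _ ≤ τ.toFun (cfc g R * x * star (cfc g R)) := by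
        refine τ.mono (cfc_mem_vN _ hR) (mul_mem (mul_mem hgN hx) (star_mem hgN)) ?_ ?_
        · exact cfc_nonneg fun t _ => le_max_right _ _
        · rw [e]; exact star_right_conjugate_le_conjugate h _
    _ ≤ _ := by simpa using τ.conj_le hx hgN h0 hn

/-- Lower semicontinuity in norm: `x - δ ≤ u k` as soon as `‖x - u k‖ < δ`, so `posPart_le` bounds
the trace of the cut-off `(x - δ)₊`. -/
theorem le_of_tendsto {x : H →L[ℂ] H} {u : ℕ → H →L[ℂ] H} (hu : ∀ k, u k ∈ N)
    (hu0 : ∀ k, 0 ≤ u k) (hlim : Tendsto u atTop (𝓝 x)) {C : ℝ≥0∞}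
    (hC : ∀ k, τ.toFun (u k) ≤ C) : τ.toFun x ≤ C := by
  have hx0 : 0 ≤ x := ge_of_tendsto' hlim hu0
  have hxsa := IsSelfAdjoint.of_nonneg hx0
  have hx : x ∈ N := (inferInstance : IsClosed (N : Set (H →L[ℂ] H))).mem_of_tendsto hlim
    (Eventually.of_forall hu)
  rw [← (CFC.posPart_eq_self x).2 hx0]
  refine τ.posPart_le_of_cutoff hx hxsa fun δ hδ => ?_
  obtain ⟨k, hk⟩ := ((Metric.tendsto_nhds.1 hlim) δ hδ).exists
  rw [dist_comm, dist_eq_norm] at hk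
  have hsa : IsSelfAdjoint (x - u k) := hxsa.sub (.of_nonneg (hu0 k))
  have h1 : x - δ • (1 : H →L[ℂ] H) ≤ u k := by
    have := hsa.le_algebraMap_norm_self
    have h2 : algebraMap ℝ (H →L[ℂ] H) ‖x - u k‖ ≤ δ • 1 := by
      rw [Algebra.algebraMap_eq_smul_one]
      exact smul_le_smul_of_nonneg_right hk.le zero_le_one
    have h3 := this.trans h2
    rw [sub_le_iff_le_add] at h3 ⊢
    rwa [add_comm]
  have h1N : x - δ • (1 : H →L[ℂ] H) ∈ N := sub_mem hx (realSmul_mem _ (one_mem N))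
  have h1sa : IsSelfAdjoint (x - δ • (1 : H →L[ℂ] H)) :=
    hxsa.sub (IsSelfAdjoint.smul (.all δ) (.one _))
  have e : (x - δ • (1 : H →L[ℂ] H))⁺ = cfc (fun t : ℝ => max (t - δ) 0) x := by
    rw [CFC.posPart_def, cfcₙ_eq_cfc, cfc_comp' (fun t : ℝ => max t 0) (fun t => t - δ) x,
      cfc_sub (fun t => t) (fun _ => δ) x, cfc_id' ℝ x, cfc_const δ x, Algebra.algebraMap_eq_smul_one]
    rfl
  rw [← e]
  exact (τ.posPart_le h1N h1sa (hu k) (hu0 k) h1).trans (hC k)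

end SemifiniteTrace

end BreuerFredholm

end

/-! ### Trace bounds by domination. -/

noncomputable section

namespace BreuerFredholm

variable {H : Type*} [NormedAddCommGroup H] [InnerProductSpace ℂ H] [CompleteSpace H]

/-- The `2 × 2` operator matrix with diagonal entries `A`, `B` and off-diagonal entries `T`, `T*` is
positive, up to the choice of signs. -/
def IsDominated (T A B : H →L[ℂ] H) : Prop :=
  ∀ x y : H, 2 * ‖inner ℂ x (T y)‖ ≤ (inner ℂ x (A x)).re + (inner ℂ y (B y)).re

theorem le_of_forall_inner_re_le {S T : H →L[ℂ] H} (hS : IsSelfAdjoint S) (hT : IsSelfAdjoint T)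
    (h : ∀ x : H, (inner ℂ x (S x)).re ≤ (inner ℂ x (T x)).re) : S ≤ T := by
  rw [ContinuousLinearMap.le_def, ContinuousLinearMap.isPositive_def']
  refine ⟨hT.sub hS, fun x => ?_⟩
  rw [ContinuousLinearMap.reApplyInnerSelf_apply, inner_re_symm]
  simpa [inner_sub_right] using h x

/-- Because `T* T = |T|²`, operators of the form `T h(|T|)` can be handled by functional calculus of
`|T|` alone, with no polar decomposition. -/
theorem star_mul_cfc_abs (T : H →L[ℂ] H) (h k : ℝ → ℝ) (hh : Continuous h) (hk : Continuous k) :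
    star (T * cfc h (CFC.abs T)) * (T * cfc k (CFC.abs T)) =
      cfc (fun t => h t * t ^ 2 * k t) (CFC.abs T) := by
  have hsh : star (cfc h (CFC.abs T)) = cfc h (CFC.abs T) :=
    (cfc_predicate h (CFC.abs T) : IsSelfAdjoint _).star_eq
  have hT : IsSelfAdjoint (CFC.abs T) := .of_nonneg (CFC.abs_nonneg T)
  rw [cfc_mul (fun t => h t * t ^ 2) k _ (by fun_prop) (by fun_prop),
    cfc_mul h (fun t => t ^ 2) _ (by fun_prop) (by fun_prop), cfc_pow_id _ 2, CFC.abs_sq, star_mul,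
    hsh]
  simp only [mul_assoc]

theorem mem_spectrum_abs {T : H →L[ℂ] H} {t : ℝ} (ht : t ∈ spectrum ℝ (CFC.abs T)) :
    0 ≤ t ∧ t ≤ ‖T‖ := by
  have ht0 : 0 ≤ t := spectrum_nonneg_of_nonneg (CFC.abs_nonneg T) ht
  refine ⟨ht0, ?_⟩
  have := spectrum.norm_le_norm_mul_of_mem ht
  rcases subsingleton_or_nontrivial H with hH | hH
  · have : Subsingleton (H →L[ℂ] H) := inferInstance
    rw [spectrum.of_subsingleton (R := ℝ) (CFC.abs T)] at ht
    exact ht.elim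
  · rwa [norm_one, mul_one, CFC.norm_abs, Real.norm_of_nonneg ht0] at this

theorem norm_mul_cfc_abs_le (T : H →L[ℂ] H) (h : ℝ → ℝ) (hh : Continuous h) {c : ℝ} (hc : 0 ≤ c)
    (hb : ∀ t, 0 ≤ t → t ≤ ‖T‖ → |h t| * t ≤ c) : ‖T * cfc h (CFC.abs T)‖ ≤ c := by
  refine abs_le_of_sq_le_sq' ?_ hc |>.2
  rw [pow_two, ← CStarRing.norm_star_mul_self, star_mul_cfc_abs T h h hh hh]
  refine norm_cfc_le (by positivity) fun t ht => ?_
  obtain ⟨ht0, ht1⟩ := mem_spectrum_abs ht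
  have := hb t ht0 ht1
  have e : h t * t ^ 2 * h t = (|h t| * t) ^ 2 := by rw [mul_pow, sq_abs]; ring
  rw [e, Real.norm_of_nonneg (by positivity)]
  gcongr

namespace SemifiniteTrace

variable {N : VonNeumannAlgebra H} (τ : SemifiniteTrace N)

/-- A bound for the norm and the trace norm of an operator in `N`, expressed by domination. -/
def TraceBound (C : ℝ≥0) (T : H →L[ℂ] H) : Prop :=
  T ∈ N ∧ ∃ A ∈ N, ∃ B ∈ N, 0 ≤ A ∧ 0 ≤ B ∧ ‖A‖ ≤ C ∧ ‖B‖ ≤ C ∧ τ.toFun A ≤ C ∧ τ.toFun B ≤ C ∧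
    IsDominated T A B

variable {τ}

theorem TraceBound.mono {C C' : ℝ≥0} {T : H →L[ℂ] H} (h : τ.TraceBound C T) (hC : C ≤ C') :
    τ.TraceBound C' T := by
  obtain ⟨hT, A, hA, B, hB, hA0, hB0, hA1, hB1, hA2, hB2, hd⟩ := h
  have h1 : (C : ℝ) ≤ C' := hC
  have h2 : (C : ℝ≥0∞) ≤ C' := by exact_mod_cast hC
  exact ⟨hT, A, hA, B, hB, hA0, hB0, hA1.trans h1, hB1.trans h1, hA2.trans h2, hB2.trans h2, hd⟩

theorem TraceBound.add {C C' : ℝ≥0} {T T' : H →L[ℂ] H} (h : τ.TraceBound C T)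
    (h' : τ.TraceBound C' T') : τ.TraceBound (C + C') (T + T') := by
  obtain ⟨hT, A, hA, B, hB, hA0, hB0, hA1, hB1, hA2, hB2, hd⟩ := h
  obtain ⟨hT', A', hA', B', hB', hA0', hB0', hA1', hB1', hA2', hB2', hd'⟩ := h'
  refine ⟨add_mem hT hT', A + A', add_mem hA hA', B + B', add_mem hB hB', add_nonneg hA0 hA0',
    add_nonneg hB0 hB0', (norm_add_le _ _).trans (add_le_add hA1 hA1'),
    (norm_add_le _ _).trans (add_le_add hB1 hB1'), ?_, ?_, fun x y => ?_⟩
  · rw [τ.map_add A hA A' hA' hA0 hA0', ENNReal.coe_add]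
    exact add_le_add hA2 hA2'
  · rw [τ.map_add B hB B' hB' hB0 hB0', ENNReal.coe_add]
    exact add_le_add hB2 hB2'
  · have h1 := hd x y
    have h2 := hd' x y
    have h3 := norm_add_le (inner ℂ x (T y)) (inner ℂ x (T' y))
    simp only [add_apply, inner_add_right, Complex.add_re]
    linarith

theorem TraceBound.smul {C : ℝ≥0} {T : H →L[ℂ] H} (h : τ.TraceBound C T) (c : ℂ) :
    τ.TraceBound (‖c‖₊ * C) (c • T) := by
  obtain ⟨hT, A, hA, B, hB, hA0, hB0, hA1, hB1, hA2, hB2, hd⟩ := h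
  refine ⟨SMulMemClass.smul_mem c hT, (‖c‖₊ : ℝ) • A, realSmul_mem _ hA, (‖c‖₊ : ℝ) • B,
    realSmul_mem _ hB, smul_nonneg (by positivity) hA0, smul_nonneg (by positivity) hB0, ?_, ?_, ?_,
    ?_, fun x y => ?_⟩
  · rw [norm_smul]; simpa using mul_le_mul_of_nonneg_left hA1 (norm_nonneg c)
  · rw [norm_smul]; simpa using mul_le_mul_of_nonneg_left hB1 (norm_nonneg c)
  · rw [τ.map_realSmul _ hA hA0, ENNReal.coe_mul]; gcongr
  · rw [τ.map_realSmul _ hB hB0, ENNReal.coe_mul]; gcongr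
  · have := mul_le_mul_of_nonneg_left (hd x y) (norm_nonneg c)
    simp only [smul_apply, inner_smul_right, norm_mul, ← Complex.coe_smul,
      Complex.re_ofReal_mul, coe_nnnorm]
    linarith

theorem TraceBound.neg {C : ℝ≥0} {T : H →L[ℂ] H} (h : τ.TraceBound C T) :
    τ.TraceBound C (-T) := by
  simpa using h.smul (-1)

theorem TraceBound.sub {C C' : ℝ≥0} {T T' : H →L[ℂ] H} (h : τ.TraceBound C T)
    (h' : τ.TraceBound C' T') : τ.TraceBound (C + C') (T - T') := by
  rw [sub_eq_add_neg]
  exact h.add h'.neg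

theorem TraceBound.zero : τ.TraceBound 0 (0 : H →L[ℂ] H) := by
  refine ⟨zero_mem N, 0, zero_mem N, 0, zero_mem N, le_rfl, le_rfl, by simp, by simp,
    by simp [τ.map_zero], by simp [τ.map_zero], fun x y => by simp⟩

theorem TraceBound.conj {C s r : ℝ≥0} {T S R : H →L[ℂ] H} (h : τ.TraceBound C T) (hS : S ∈ N)
    (hR : R ∈ N) (hs : 0 < s) (hr : 0 < r) (hSs : ‖S‖ ≤ s) (hRr : ‖R‖ ≤ r) :
    τ.TraceBound (s * r * C) (S * T * R) := by
  obtain ⟨hT, A, hA, B, hB, hA0, hB0, hA1, hB1, hA2, hB2, hd⟩ := h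
  have hs' := hs.ne'
  have hr' := hr.ne'
  have hSA := star_right_conjugate_nonneg hA0 S
  have hRB := star_left_conjugate_nonneg hB0 R
  have hSAN := mul_mem (mul_mem hS hA) (star_mem hS)
  have hRBN := mul_mem (mul_mem (star_mem hR) hB) hR
  refine ⟨mul_mem (mul_mem hS hT) hR, ((r / s : ℝ≥0) : ℝ) • (S * A * star S),
    realSmul_mem _ hSAN, ((s / r : ℝ≥0) : ℝ) • (star R * B * R), realSmul_mem _ hRBN,
    smul_nonneg (r / s).2 hSA, smul_nonneg (s / r).2 hRB, ?_, ?_, ?_, ?_, fun x y => ?_⟩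
  · rw [norm_smul, Real.norm_of_nonneg (r / s).coe_nonneg]
    calc _ ≤ ((r / s : ℝ≥0) : ℝ) * (s * C * s) := by
          gcongr
          refine (norm_mul_le _ _).trans ?_
          rw [norm_star]
          gcongr
          exact (norm_mul_le _ _).trans (by gcongr)
      _ = _ := by push_cast; field_simp
  · rw [norm_smul, Real.norm_of_nonneg (s / r).coe_nonneg]
    calc _ ≤ ((s / r : ℝ≥0) : ℝ) * (r * C * r) := by
          gcongr
          refine (norm_mul_le _ _).trans ?_
          gcongr
          refine (norm_mul_le _ _).trans ?_
          rw [norm_star]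
          gcongr
      _ = _ := by push_cast; field_simp
  · rw [τ.map_realSmul _ hSAN hSA]
    calc _ ≤ ((r / s : ℝ≥0) : ℝ≥0∞) * ((s ^ 2 : ℝ≥0) * C) := by
          gcongr
          exact (τ.conj_le hA hS hA0 hSs).trans (by gcongr)
      _ = _ := by
          rw [← ENNReal.coe_mul, ← ENNReal.coe_mul]
          congr 1
          field_simp
  · rw [τ.map_realSmul _ hRBN hRB]
    calc _ ≤ ((s / r : ℝ≥0) : ℝ≥0∞) * ((r ^ 2 : ℝ≥0) * C) := by
          gcongr
          have := τ.conj_le (s := star R) (c := r) hB (star_mem hR) hB0 (by rwa [norm_star])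
          rw [star_star] at this
          exact this.trans (by gcongr)
      _ = _ := by
          rw [← ENNReal.coe_mul, ← ENNReal.coe_mul]
          congr 1
          field_simp
  · have h0 : (0 : ℝ) < r / s := by positivity
    -- Domination is applied to `l S* x` and `l⁻¹ R y`; rescaling by `l` leaves the mixed term alone
    -- and gives both dominating operators the same bound `s r C`.
    set l : ℝ := Real.sqrt (r / s) with hl
    have hl0 : 0 < l := Real.sqrt_pos.2 h0
    have hl2 : l * l = r / s := Real.mul_self_sqrt h0.le
    have hl2' : l⁻¹ * l⁻¹ = s / r := by rw [← mul_inv, hl2, inv_div]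
    have hdd := hd ((l : ℂ) • star S x) (((l⁻¹ : ℝ) : ℂ) • R y)
    have hlc : (l : ℂ) * ((l⁻¹ : ℝ) : ℂ) = 1 := by
      rw [← Complex.ofReal_mul, mul_inv_cancel₀ hl0.ne']; simp
    have adjS : ∀ v w : H, inner ℂ (star S v) w = inner ℂ v (S w) := fun v w =>
      ContinuousLinearMap.adjoint_inner_left S w v
    have adjR : ∀ v w : H, inner ℂ v (star R w) = inner ℂ (R v) w := fun v w =>
      ContinuousLinearMap.adjoint_inner_right R v w
    have e1 : inner ℂ ((l : ℂ) • star S x) (T (((l⁻¹ : ℝ) : ℂ) • R y)) =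
        inner ℂ x ((S * T * R) y) := by
      rw [_root_.map_smul, inner_smul_left, inner_smul_right, Complex.conj_ofReal, ← mul_assoc, hlc,
        one_mul, adjS]; rfl
    have e2 : (inner ℂ ((l : ℂ) • star S x) (A ((l : ℂ) • star S x))).re =
        (inner ℂ x ((((r / s : ℝ≥0) : ℝ) • (S * A * star S)) x)).re := by
      rw [_root_.map_smul, inner_smul_left, inner_smul_right, Complex.conj_ofReal, ← mul_assoc,
        ← Complex.ofReal_mul, hl2, adjS, ← Complex.coe_smul, smul_apply,
        inner_smul_right]
      push_cast; rfl
    have e3 : (inner ℂ (((l⁻¹ : ℝ) : ℂ) • R y) (B (((l⁻¹ : ℝ) : ℂ) • R y))).re =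
        (inner ℂ y ((((s / r : ℝ≥0) : ℝ) • (star R * B * R)) y)).re := by
      rw [_root_.map_smul, inner_smul_left, inner_smul_right, Complex.conj_ofReal, ← mul_assoc,
        ← Complex.ofReal_mul, hl2', ← adjR, ← Complex.coe_smul,
        smul_apply, inner_smul_right]
      push_cast; rfl
    rw [e1, e2, e3] at hdd
    exact hdd

/-- Cauchy–Schwarz for `⟨V* x, K y⟩`: the product of two Hilbert–Schmidt operators is dominated by
`V V*` and `K* K`. -/
theorem TraceBound.factor {V K : H →L[ℂ] H} (hV : V ∈ N) (hK : K ∈ N) {C : ℝ≥0}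
    (hV1 : ‖V‖ ^ 2 ≤ C) (hK1 : ‖K‖ ^ 2 ≤ C) (hV2 : τ.toFun (star V * V) ≤ C)
    (hK2 : τ.toFun (star K * K) ≤ C) : τ.TraceBound C (V * K) := by
  refine ⟨mul_mem hV hK, V * star V, mul_mem hV (star_mem hV), star K * K,
    mul_mem (star_mem hK) hK, mul_star_self_nonneg V, star_mul_self_nonneg K, ?_, ?_, ?_, hK2,
    fun x y => ?_⟩
  · rwa [CStarRing.norm_self_mul_star, ← pow_two]
  · rwa [CStarRing.norm_star_mul_self, ← pow_two]
  · rwa [← τ.tracial V hV]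
  · have adjV : ∀ v w : H, inner ℂ v (V w) = inner ℂ (star V v) w := fun v w =>
      (ContinuousLinearMap.adjoint_inner_left V w v).symm
    have adjK : ∀ v w : H, inner ℂ v (star K w) = inner ℂ (K v) w := fun v w =>
      ContinuousLinearMap.adjoint_inner_right K v w
    have h1 : (inner ℂ x ((V * star V) x)).re = ‖star V x‖ ^ 2 := by
      change (inner ℂ x (V (star V x))).re = _
      rw [adjV, ← Complex.ofReal_re (‖star V x‖ ^ 2), Complex.ofReal_pow]
      exact congrArg Complex.re (inner_self_eq_norm_sq_to_K _)
    have h2 : (inner ℂ y ((star K * K) y)).re = ‖K y‖ ^ 2 := by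
      change (inner ℂ y (star K (K y))).re = _
      rw [adjK, ← Complex.ofReal_re (‖K y‖ ^ 2), Complex.ofReal_pow]
      exact congrArg Complex.re (inner_self_eq_norm_sq_to_K _)
    have h3 : ‖inner ℂ x ((V * K) y)‖ ≤ ‖star V x‖ * ‖K y‖ := by
      change ‖inner ℂ x (V (K y))‖ ≤ _
      rw [adjV]
      exact norm_inner_le_norm _ _
    rw [h1, h2]
    nlinarith [sq_nonneg (‖star V x‖ - ‖K y‖)]

theorem sum_range_le {A : ℕ → H →L[ℂ] H} {c : ℕ → ℝ≥0} (hA : ∀ j, A j ∈ N) (hA0 : ∀ j, 0 ≤ A j)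
    (hc : ∀ j, τ.toFun (A j) ≤ c j) (n : ℕ) :
    τ.toFun (∑ j ∈ Finset.range n, A j) ≤ (∑ j ∈ Finset.range n, c j : ℝ≥0) := by
  induction n with
  | zero => simp [τ.map_zero]
  | succ n ih =>
    rw [Finset.sum_range_succ, Finset.sum_range_succ,
      τ.map_add _ (sum_mem fun j _ => hA j) _ (hA n) (Finset.sum_nonneg fun j _ => hA0 j) (hA0 n),
      ENNReal.coe_add]
    exact add_le_add ih (hc n)

/-- This is why `TraceBound` also controls `‖A‖` and `‖B‖`: the dominating operators then sum in
norm, and lower semicontinuity bounds the trace of their sums. -/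
theorem TraceBound.hasSum {T : H →L[ℂ] H} {t : ℕ → H →L[ℂ] H} {c : ℕ → ℝ≥0} (hc : Summable c)
    (ht : ∀ j, τ.TraceBound (c j) (t j)) (hT : HasSum t T) : τ.TraceBound (∑' j, c j) T := by
  choose htN A hA B hB hA0 hB0 hA1 hB1 hA2 hB2 hd using ht
  have hc' : Summable fun j => (c j : ℝ) := NNReal.summable_coe.2 hc
  have hcl : IsClosed (N : Set (H →L[ℂ] H)) := inferInstance
  have key : ∀ D : ℕ → H →L[ℂ] H, (∀ j, D j ∈ N) → (∀ j, 0 ≤ D j) → (∀ j, ‖D j‖ ≤ c j) →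
      (∀ j, τ.toFun (D j) ≤ c j) → HasSum D (∑' j, D j) ∧ (∑' j, D j) ∈ N ∧ 0 ≤ (∑' j, D j) ∧
        ‖∑' j, D j‖ ≤ (∑' j, c j : ℝ≥0) ∧ τ.toFun (∑' j, D j) ≤ (∑' j, c j : ℝ≥0) := by
    intro D hD hD0 hD1 hD2
    have hs : HasSum D (∑' j, D j) := (Summable.of_norm_bounded hc' hD1).hasSum
    refine ⟨hs, hcl.mem_of_tendsto hs.tendsto_sum_nat
      (Eventually.of_forall fun n => sum_mem fun j _ => hD j),
      ge_of_tendsto' hs.tendsto_sum_nat fun n => Finset.sum_nonneg fun j _ => hD0 j, ?_, ?_⟩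
    · rw [NNReal.coe_tsum]
      exact tsum_of_norm_bounded hc'.hasSum hD1
    · refine τ.le_of_tendsto (fun n => sum_mem fun j _ => hD j)
        (fun n => Finset.sum_nonneg fun j _ => hD0 j) hs.tendsto_sum_nat fun n => ?_
      refine (sum_range_le hD hD0 hD2 n).trans ?_
      exact_mod_cast hc.sum_le_tsum _ (fun _ _ => zero_le)
  obtain ⟨sA, nA, pA, bA, tA⟩ := key A hA hA0 hA1 hA2
  obtain ⟨sB, nB, pB, bB, tB⟩ := key B hB hB0 hB1 hB2
  refine ⟨hcl.mem_of_tendsto hT.tendsto_sum_nat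
      (Eventually.of_forall fun n => sum_mem fun j _ => htN j), _, nA, _, nB, pA, pB, bA, bB, tA,
      tB, fun x y => ?_⟩
  have ev : ∀ {D : ℕ → H →L[ℂ] H} {E : H →L[ℂ] H}, HasSum D E → ∀ x y : H,
      Tendsto (fun n => inner ℂ x ((∑ j ∈ Finset.range n, D j) y)) atTop (𝓝 (inner ℂ x (E y))) := by
    intro D E hDE x y
    have : Continuous fun S : H →L[ℂ] H => inner ℂ x (S y) := by fun_prop
    exact (this.tendsto E).comp hDE.tendsto_sum_nat
  refine le_of_tendsto_of_tendsto' ((ev hT x y).norm.const_mul 2)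
    (((Complex.continuous_re.tendsto _).comp (ev sA x x)).add
      ((Complex.continuous_re.tendsto _).comp (ev sB y y))) fun n => ?_
  simp only [Function.comp_apply, sum_apply, inner_sum, Complex.re_sum]
  rw [← Finset.sum_add_distrib]
  refine (mul_le_mul_of_nonneg_left (norm_sum_le _ _) zero_le_two).trans ?_
  rw [Finset.mul_sum]
  exact Finset.sum_le_sum fun j _ => hd j x y

/-- The contractions `W k = T (|T| + e k)⁻¹` stand in for the phase of `T`: `W k* T` tends to `|T|`
in norm. Domination at `x = W k y` gives `2 W k* T ≤ W k* A W k + B`, whose trace is at most `2 C`.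
-/
theorem TraceBound.abs_le {C : ℝ≥0} {T : H →L[ℂ] H} (h : τ.TraceBound C T) :
    τ.toFun (CFC.abs T) ≤ C := by
  obtain ⟨hT, A, hA, B, hB, hA0, hB0, hA1, hB1, hA2, hB2, hd⟩ := h
  set e : ℕ → ℝ := fun k => 1 / ((k : ℝ) + 1) with he
  have he0 : ∀ k, 0 < e k := fun k => Nat.one_div_pos_of_nat
  set g : ℕ → ℝ → ℝ := fun k t => 1 / (|t| + e k) with hg
  have hne : ∀ k t, 0 < |t| + e k := fun k t => add_pos_of_nonneg_of_pos (abs_nonneg t) (he0 k)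
  have hgc : ∀ k, Continuous (g k) := by
    intro k
    have : ∀ t : ℝ, |t| + e k ≠ 0 := fun t => (hne k t).ne'
    fun_prop (disch := assumption)
  set W : ℕ → H →L[ℂ] H := fun k => T * cfc (g k) (CFC.abs T) with hW
  have hWN : ∀ k, W k ∈ N := fun k => mul_mem hT (cfc_mem_vN _ (abs_mem hT))
  have hW1 : ∀ k, ‖W k‖ ≤ 1 := by
    intro k
    refine norm_mul_cfc_abs_le T _ (hgc k) zero_le_one fun t ht _ => ?_
    rw [hg, abs_of_nonneg (by positivity [hne k t]), div_mul_eq_mul_div, one_mul,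
      div_le_one (hne k t)]
    linarith [le_abs_self t, he0 k]
  have hsaT : IsSelfAdjoint (CFC.abs T) := .of_nonneg (CFC.abs_nonneg T)
  have hu : ∀ k, star (W k) * T = cfc (fun t => g k t * t ^ 2) (CFC.abs T) := by
    intro k
    have := star_mul_cfc_abs T (g k) (fun _ => 1) (hgc k) continuous_const
    rw [cfc_const_one ℝ (CFC.abs T), mul_one] at this
    simpa only [mul_one] using this
  have hu0 : ∀ k, 0 ≤ star (W k) * T := by
    intro k
    rw [hu]
    exact cfc_nonneg fun t _ => mul_nonneg (one_div_nonneg.2 (hne k t).le) (sq_nonneg t)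
  refine τ.le_of_tendsto (u := fun k => star (W k) * T) (fun k => mul_mem (star_mem (hWN k)) hT)
    hu0 ?_ fun k => ?_
  · rw [tendsto_iff_norm_sub_tendsto_zero]
    refine squeeze_zero (fun _ => norm_nonneg _) (g := e) (fun k => ?_)
      tendsto_one_div_add_atTop_nhds_zero_nat
    have : star (W k) * T - CFC.abs T = cfc (fun t => g k t * t ^ 2 - t) (CFC.abs T) := by
      rw [cfc_sub (fun t => g k t * t ^ 2) (fun t => t) _ (by fun_prop) (by fun_prop),
        cfc_id' ℝ (CFC.abs T), hu]
    rw [this]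
    refine norm_cfc_le (he0 k).le fun t ht => ?_
    have ht0 : 0 ≤ t := spectrum_nonneg_of_nonneg (CFC.abs_nonneg T) ht
    have h1 : 0 < t + e k := add_pos_of_nonneg_of_pos ht0 (he0 k)
    have : g k t * t ^ 2 - t = -(e k * (t / (t + e k))) := by
      simp only [hg, abs_of_nonneg ht0]
      field_simp
      ring
    rw [this, norm_neg, Real.norm_of_nonneg (mul_nonneg (he0 k).le (by positivity))]
    exact mul_le_of_le_one_right (he0 k).le ((div_le_one h1).2 (by linarith [he0 k]))
  · have hAW := star_left_conjugate_nonneg hA0 (W k)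
    have hAWN := mul_mem (mul_mem (star_mem (hWN k)) hA) (hWN k)
    have hle : star (W k) * T ≤ ((1 / 2 : ℝ≥0) : ℝ) • (star (W k) * A * W k + B) := by
      refine le_of_forall_inner_re_le (.of_nonneg (hu0 k))
        (.of_nonneg (smul_nonneg (1 / 2 : ℝ≥0).2 (add_nonneg hAW hB0))) fun y => ?_
      have adjW : ∀ v w : H, inner ℂ v (star (W k) w) = inner ℂ (W k v) w := fun v w =>
        ContinuousLinearMap.adjoint_inner_right (W k) v w
      have h1 := hd (W k y) y
      have h2 : inner ℂ y ((star (W k) * T) y) = inner ℂ (W k y) (T y) := adjW _ _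
      have h3 : inner ℂ y ((star (W k) * A * W k) y) = inner ℂ (W k y) (A (W k y)) := adjW _ _
      have h4 := Complex.re_le_norm (inner ℂ (W k y) (T y))
      rw [← Complex.coe_smul, smul_apply, inner_smul_right,
        Complex.re_ofReal_mul, add_apply, inner_add_right, Complex.add_re, h2, h3]
      push_cast
      linarith
    refine (τ.mono (mul_mem (star_mem (hWN k)) hT) (realSmul_mem _ (add_mem hAWN hB)) (hu0 k)
      hle).trans ?_
    rw [τ.map_realSmul _ (add_mem hAWN hB) (add_nonneg hAW hB0), τ.map_add _ hAWN _ hB hAW hB0]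
    have h5 : τ.toFun (star (W k) * A * W k) ≤ C := by
      have := τ.conj_le (s := star (W k)) (c := 1) hA (star_mem (hWN k)) hA0
        (by rw [norm_star]; exact hW1 k)
      rw [star_star] at this
      refine this.trans (by simpa using hA2)
    calc _ ≤ ((1 / 2 : ℝ≥0) : ℝ≥0∞) * (C + C) := by gcongr
      _ = C := by
          rw [← ENNReal.coe_add, ← ENNReal.coe_mul]
          congr 1
          rw [← two_mul, ← mul_assoc]; norm_num

theorem TraceBound.isSummable_one {C : ℝ≥0} {T : H →L[ℂ] H} (h : τ.TraceBound C T) :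
    τ.IsSummable 1 T := by
  refine ⟨h.1, ?_⟩
  rw [pNorm, CFC.rpow_one _ (CFC.abs_nonneg T)]
  simpa using h.abs_le.trans_lt ENNReal.coe_lt_top

end SemifiniteTrace

end BreuerFredholm

end

/-! ### Linearity and cyclicity of the trace. -/

noncomputable section

namespace BreuerFredholm

variable {H : Type*} [NormedAddCommGroup H] [InnerProductSpace ℂ H] [CompleteSpace H]

namespace SemifiniteTrace

variable {N : VonNeumannAlgebra H} (τ : SemifiniteTrace N)

/-- The difference of the traces of the positive and the negative part. -/
def saTrace (R : H →L[ℂ] H) : ℝ := (τ.toFun R⁺).toReal - (τ.toFun R⁻).toReal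

theorem trace_eq (T : H →L[ℂ] H) : τ.trace T =
    (τ.saTrace (ℜ T : H →L[ℂ] H) : ℂ) + Complex.I * (τ.saTrace (ℑ T : H →L[ℂ] H) : ℂ) := rfl

variable {τ}

theorem negPart_le {R x : H →L[ℂ] H} (hR : R ∈ N) (hsa : IsSelfAdjoint R) (hx : x ∈ N)
    (h0 : 0 ≤ x) (h : -R ≤ x) : τ.toFun R⁻ ≤ τ.toFun x := by
  rw [← CFC.posPart_neg]
  exact τ.posPart_le (neg_mem hR) hsa.neg hx h0 h

/-- Any splitting into positive operators of finite trace computes the same number: apply the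
additive `τ` to `(x - y)⁺ + y = x + (x - y)⁻`, where all terms are finite by `posPart_le`.
Additivity of the trace rests on this. -/
theorem saTrace_sub {x y : H →L[ℂ] H} (hx : x ∈ N) (hy : y ∈ N) (hx0 : 0 ≤ x) (hy0 : 0 ≤ y)
    (hxt : τ.toFun x ≠ ∞) (hyt : τ.toFun y ≠ ∞) :
    τ.saTrace (x - y) = (τ.toFun x).toReal - (τ.toFun y).toReal := by
  have hR : x - y ∈ N := sub_mem hx hy
  have hsa : IsSelfAdjoint (x - y) := (IsSelfAdjoint.of_nonneg hx0).sub (.of_nonneg hy0)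
  have h1 := τ.posPart_le hR hsa hx hx0 (sub_le_self x hy0)
  have h2 := negPart_le (τ := τ) hR hsa hy hy0 (by rw [neg_sub]; exact sub_le_self y hx0)
  have f1 : τ.toFun (x - y)⁺ ≠ ∞ := ne_top_of_le_ne_top hxt h1
  have f2 : τ.toFun (x - y)⁻ ≠ ∞ := ne_top_of_le_ne_top hyt h2
  have e : (x - y)⁺ + y = x + (x - y)⁻ := by
    have := CFC.posPart_sub_negPart (x - y) hsa
    rw [sub_eq_iff_eq_add] at this
    rw [this]; abel
  have e2 := congrArg τ.toFun e
  rw [τ.map_add _ (posPart_mem hR) _ hy (CFC.posPart_nonneg _) hy0,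
    τ.map_add _ hx _ (negPart_mem hR) hx0 (CFC.negPart_nonneg _)] at e2
  have e3 := congrArg ENNReal.toReal e2
  rw [ENNReal.toReal_add f1 hyt, ENNReal.toReal_add hxt f2] at e3
  rw [saTrace]
  linarith

variable (τ) in
/-- The self-adjoint operators in `N` whose positive and negative part have finite trace. -/
def SaFinite (R : H →L[ℂ] H) : Prop :=
  R ∈ N ∧ IsSelfAdjoint R ∧ τ.toFun R⁺ ≠ ∞ ∧ τ.toFun R⁻ ≠ ∞

theorem saTrace_add {R S : H →L[ℂ] H} (hR : τ.SaFinite R) (hS : τ.SaFinite S) :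
    τ.saTrace (R + S) = τ.saTrace R + τ.saTrace S := by
  obtain ⟨hR, sR, pR, nR⟩ := hR
  obtain ⟨hS, sS, pS, nS⟩ := hS
  have e : R + S = (R⁺ + S⁺) - (R⁻ + S⁻) := by
    conv_lhs => rw [← CFC.posPart_sub_negPart R sR, ← CFC.posPart_sub_negPart S sS]
    abel
  have a1 := τ.map_add _ (posPart_mem hR) _ (posPart_mem hS) (CFC.posPart_nonneg R)
    (CFC.posPart_nonneg S)
  have a2 := τ.map_add _ (negPart_mem hR) _ (negPart_mem hS) (CFC.negPart_nonneg R)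
    (CFC.negPart_nonneg S)
  rw [e, saTrace_sub (add_mem (posPart_mem hR) (posPart_mem hS))
    (add_mem (negPart_mem hR) (negPart_mem hS))
    (add_nonneg (CFC.posPart_nonneg R) (CFC.posPart_nonneg S))
    (add_nonneg (CFC.negPart_nonneg R) (CFC.negPart_nonneg S))
    (by rw [a1]; exact ENNReal.add_ne_top.2 ⟨pR, pS⟩)
    (by rw [a2]; exact ENNReal.add_ne_top.2 ⟨nR, nS⟩), a1, a2, ENNReal.toReal_add pR pS,
    ENNReal.toReal_add nR nS, saTrace, saTrace]
  ring

theorem saTrace_neg (R : H →L[ℂ] H) : τ.saTrace (-R) = -τ.saTrace R := by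
  rw [saTrace, saTrace, CFC.posPart_neg, CFC.negPart_neg]; ring

theorem saTrace_smul (c : ℝ) {R : H →L[ℂ] H} (hR : R ∈ N) :
    τ.saTrace (c • R) = c * τ.saTrace R := by
  have key : ∀ (c : ℝ≥0), τ.saTrace ((c : ℝ) • R) = c * τ.saTrace R := by
    intro c
    rw [saTrace, CFC.posPart_smul_of_nonneg c.coe_nonneg, CFC.negPart_smul_of_nonneg c.coe_nonneg,
      τ.map_realSmul c (posPart_mem hR) (CFC.posPart_nonneg R),
      τ.map_realSmul c (negPart_mem hR) (CFC.negPart_nonneg R), ENNReal.toReal_mul,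
      ENNReal.toReal_mul, saTrace]
    simp only [ENNReal.coe_toReal]; ring
  rcases le_total 0 c with h | h
  · exact key ⟨c, h⟩
  · have := key ⟨-c, by linarith⟩
    change τ.saTrace ((-c) • R) = -c * τ.saTrace R at this
    rw [neg_smul, saTrace_neg] at this
    linarith

/-- Domination on the diagonal `x = y` says that `ℜ T` and `-ℜ T` both lie below `(A + B) / 2`. -/
theorem TraceBound.saFinite_realPart_le {C : ℝ≥0} {T : H →L[ℂ] H} (h : τ.TraceBound C T) :
    τ.SaFinite (ℜ T) ∧ τ.toFun (ℜ T : H →L[ℂ] H)⁺ ≤ C ∧ τ.toFun (ℜ T : H →L[ℂ] H)⁻ ≤ C := by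
  obtain ⟨hT, A, hA, B, hB, hA0, hB0, hA1, hB1, hA2, hB2, hd⟩ := h
  set D : H →L[ℂ] H := ((1 / 2 : ℝ≥0) : ℝ) • (A + B) with hD
  have hDN : D ∈ N := realSmul_mem _ (add_mem hA hB)
  have hD0 : 0 ≤ D := smul_nonneg (1 / 2 : ℝ≥0).2 (add_nonneg hA0 hB0)
  have hDt : τ.toFun D ≤ C := by
    rw [hD, τ.map_realSmul _ (add_mem hA hB) (add_nonneg hA0 hB0), τ.map_add _ hA _ hB hA0 hB0]
    calc _ ≤ ((1 / 2 : ℝ≥0) : ℝ≥0∞) * (C + C) := by gcongr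
      _ = C := by
          rw [← ENNReal.coe_add, ← ENNReal.coe_mul]
          congr 1
          rw [← two_mul, ← mul_assoc]; norm_num
  have hsa : IsSelfAdjoint (ℜ T : H →L[ℂ] H) := (ℜ T).2
  have hRN : (ℜ T : H →L[ℂ] H) ∈ N := realPart_mem hT
  have hin : ∀ x, (inner ℂ x ((ℜ T : H →L[ℂ] H) x)).re = (inner ℂ x (T x)).re := by
    intro x
    have adj : inner ℂ x (star T x) = inner ℂ (T x) x :=
      ContinuousLinearMap.adjoint_inner_right T x x
    have h1 : (inner ℂ (T x) x).re = (inner ℂ x (T x)).re := inner_re_symm (𝕜 := ℂ) _ _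
    rw [realPart_apply_coe, ← Complex.coe_smul, smul_apply, inner_smul_right,
      Complex.re_ofReal_mul, add_apply, inner_add_right, Complex.add_re, adj, h1]
    ring
  have hinD : ∀ x, ‖inner ℂ x (T x)‖ ≤ (inner ℂ x (D x)).re := by
    intro x
    rw [hD, ← Complex.coe_smul, smul_apply, inner_smul_right, Complex.re_ofReal_mul, add_apply,
      inner_add_right, Complex.add_re]
    have := hd x x
    push_cast
    linarith
  have h1 : (ℜ T : H →L[ℂ] H) ≤ D := by
    refine le_of_forall_inner_re_le hsa (.of_nonneg hD0) fun x => ?_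
    rw [hin]
    exact (Complex.re_le_norm _).trans (hinD x)
  have h2 : -(ℜ T : H →L[ℂ] H) ≤ D := by
    refine le_of_forall_inner_re_le hsa.neg (.of_nonneg hD0) fun x => ?_
    rw [neg_apply, inner_neg_right, Complex.neg_re, hin]
    exact (neg_le_abs _).trans ((Complex.abs_re_le_norm _).trans (hinD x))
  have p1 := (τ.posPart_le hRN hsa hDN hD0 h1).trans hDt
  have p2 := (negPart_le hRN hsa hDN hD0 h2).trans hDt
  exact ⟨⟨hRN, hsa, ne_top_of_le_ne_top ENNReal.coe_ne_top p1,
    ne_top_of_le_ne_top ENNReal.coe_ne_top p2⟩, p1, p2⟩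

theorem imaginaryPart_eq_realPart (T : H →L[ℂ] H) : ℑ T = ℜ ((-Complex.I) • T) := by
  simp

theorem TraceBound.saFinite_imaginaryPart_le {C : ℝ≥0} {T : H →L[ℂ] H} (h : τ.TraceBound C T) :
    τ.SaFinite (ℑ T) ∧ τ.toFun (ℑ T : H →L[ℂ] H)⁺ ≤ C ∧ τ.toFun (ℑ T : H →L[ℂ] H)⁻ ≤ C := by
  rw [imaginaryPart_eq_realPart]
  have := h.smul (-Complex.I)
  simp only [nnnorm_neg, Complex.nnnorm_I, one_mul] at this
  exact this.saFinite_realPart_le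

theorem abs_toReal_sub_toReal_le {a b : ℝ≥0∞} {C : ℝ≥0} (ha : a ≤ C) (hb : b ≤ C) :
    |a.toReal - b.toReal| ≤ C := by
  have h1 := ENNReal.toReal_mono ENNReal.coe_ne_top ha
  have h2 := ENNReal.toReal_mono ENNReal.coe_ne_top hb
  have h3 : 0 ≤ a.toReal := ENNReal.toReal_nonneg
  have h4 : 0 ≤ b.toReal := ENNReal.toReal_nonneg
  rw [ENNReal.coe_toReal] at h1 h2
  exact abs_le.2 ⟨by linarith, by linarith⟩

theorem TraceBound.norm_trace_le {C : ℝ≥0} {T : H →L[ℂ] H} (h : τ.TraceBound C T) :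
    ‖τ.trace T‖ ≤ 2 * C := by
  obtain ⟨-, h1, h2⟩ := h.saFinite_realPart_le
  obtain ⟨-, h3, h4⟩ := h.saFinite_imaginaryPart_le
  rw [trace_eq]
  refine (norm_add_le _ _).trans ?_
  rw [norm_mul, Complex.norm_I, one_mul, Complex.norm_real, Complex.norm_real, two_mul]
  exact add_le_add (abs_toReal_sub_toReal_le h1 h2) (abs_toReal_sub_toReal_le h3 h4)

variable (τ) in
/-- The trace class operators, described by domination. -/
def IsTraceClass (T : H →L[ℂ] H) : Prop := ∃ C : ℝ≥0, τ.TraceBound C T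

namespace IsTraceClass

variable {S T : H →L[ℂ] H}

theorem add (hS : τ.IsTraceClass S) (hT : τ.IsTraceClass T) : τ.IsTraceClass (S + T) :=
  let ⟨_, h⟩ := hS; let ⟨_, h'⟩ := hT; ⟨_, h.add h'⟩

theorem sub (hS : τ.IsTraceClass S) (hT : τ.IsTraceClass T) : τ.IsTraceClass (S - T) :=
  let ⟨_, h⟩ := hS; let ⟨_, h'⟩ := hT; ⟨_, h.sub h'⟩

theorem neg (hT : τ.IsTraceClass T) : τ.IsTraceClass (-T) := let ⟨_, h⟩ := hT; ⟨_, h.neg⟩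

theorem smul (c : ℂ) (hT : τ.IsTraceClass T) : τ.IsTraceClass (c • T) :=
  let ⟨_, h⟩ := hT; ⟨_, h.smul c⟩

theorem mul_left (hT : τ.IsTraceClass T) (hS : S ∈ N) : τ.IsTraceClass (S * T) := by
  obtain ⟨C, h⟩ := hT
  have h1 : (‖S‖ : ℝ) ≤ (‖S‖₊ + 1 : ℝ≥0) := by push_cast; linarith
  have h2 : ‖(1 : H →L[ℂ] H)‖ ≤ (1 : ℝ≥0) := by
    rw [NNReal.coe_one]; exact ContinuousLinearMap.norm_id_le
  have := h.conj hS (one_mem N) (by positivity) one_pos h1 h2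
  rw [mul_one] at this
  exact ⟨_, this⟩

theorem mul_right (hT : τ.IsTraceClass T) (hS : S ∈ N) : τ.IsTraceClass (T * S) := by
  obtain ⟨C, h⟩ := hT
  have h1 : (‖S‖ : ℝ) ≤ (‖S‖₊ + 1 : ℝ≥0) := by push_cast; linarith
  have h2 : ‖(1 : H →L[ℂ] H)‖ ≤ (1 : ℝ≥0) := by
    rw [NNReal.coe_one]; exact ContinuousLinearMap.norm_id_le
  have := h.conj (one_mem N) hS one_pos (by positivity) h2 h1
  rw [one_mul] at this
  exact ⟨_, this⟩

theorem star_mul (hS : S ∈ N) (hT : T ∈ N) (hS1 : τ.toFun (star S * S) ≠ ∞)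
    (hT1 : τ.toFun (star T * T) ≠ ∞) : τ.IsTraceClass (star S * T) := by
  set C : ℝ≥0 := ‖S‖₊ ^ 2 + ‖T‖₊ ^ 2 + (τ.toFun (star S * S)).toNNReal +
    (τ.toFun (star T * T)).toNNReal with hC
  have c1 : ‖S‖₊ ^ 2 ≤ C := by rw [hC, add_assoc, add_assoc]; exact le_self_add
  have c2 : ‖T‖₊ ^ 2 ≤ C := by
    rw [hC, add_assoc, add_comm (‖S‖₊ ^ 2), add_assoc]; exact le_self_add
  have c3 : (τ.toFun (star S * S)).toNNReal ≤ C := by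
    rw [hC, add_comm (_ + _) (τ.toFun (star S * S)).toNNReal, add_assoc]; exact le_self_add
  have c4 : (τ.toFun (star T * T)).toNNReal ≤ C := le_add_self
  refine ⟨C, TraceBound.factor (star_mem hS) hT ?_ (by exact_mod_cast c2) ?_ ?_⟩
  · rw [norm_star]; exact_mod_cast c1
  · rw [star_star, ← τ.tracial S hS, ← ENNReal.coe_toNNReal hS1]
    exact_mod_cast c3
  · rw [← ENNReal.coe_toNNReal hT1]
    exact_mod_cast c4

theorem of_nonneg (hT : T ∈ N) (h0 : 0 ≤ T) (h : τ.toFun T ≠ ∞) : τ.IsTraceClass T := by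
  have hs := (IsSelfAdjoint.of_nonneg (CFC.sqrt_nonneg T)).star_eq
  have e : star (CFC.sqrt T) * CFC.sqrt T = T := by rw [hs, CFC.sqrt_mul_sqrt_self T]
  have := star_mul (τ := τ) (sqrt_mem hT) (sqrt_mem hT) (by rwa [e]) (by rwa [e])
  rwa [e] at this

theorem toFun_ne_top (h : τ.IsTraceClass T) (h0 : 0 ≤ T) : τ.toFun T ≠ ∞ := by
  obtain ⟨C, h⟩ := h
  have := h.abs_le
  rw [CFC.abs_of_nonneg T h0] at this
  exact ne_top_of_le_ne_top ENNReal.coe_ne_top this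

end IsTraceClass

variable {S T : H →L[ℂ] H}

theorem trace_add (hS : τ.IsTraceClass S) (hT : τ.IsTraceClass T) :
    τ.trace (S + T) = τ.trace S + τ.trace T := by
  obtain ⟨C, hS⟩ := hS
  obtain ⟨C', hT⟩ := hT
  simp only [trace_eq, _root_.map_add, AddSubgroup.coe_add]
  rw [saTrace_add hS.saFinite_realPart_le.1 hT.saFinite_realPart_le.1,
    saTrace_add hS.saFinite_imaginaryPart_le.1 hT.saFinite_imaginaryPart_le.1]
  push_cast; ring

theorem trace_realSmul (c : ℝ) (hT : T ∈ N) : τ.trace (c • T) = c * τ.trace T := by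
  simp only [trace_eq, _root_.map_smul, selfAdjoint.val_smul]
  rw [saTrace_smul c (realPart_mem hT), saTrace_smul c (imaginaryPart_mem hT)]
  push_cast; ring

theorem trace_I_smul (T : H →L[ℂ] H) : τ.trace (Complex.I • T) = Complex.I * τ.trace T := by
  simp only [trace_eq, realPart_I_smul, imaginaryPart_I_smul, NegMemClass.coe_neg, saTrace_neg]
  push_cast
  linear_combination (-(τ.saTrace (ℑ T : H →L[ℂ] H) : ℂ)) * Complex.I_mul_I

theorem trace_smul (c : ℂ) (hT : τ.IsTraceClass T) : τ.trace (c • T) = c * τ.trace T := by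
  have hTN : T ∈ N := hT.choose_spec.1
  have e : c • T = c.re • T + Complex.I • (c.im • T) := by
    rw [← Complex.coe_smul, ← Complex.coe_smul, smul_smul, ← add_smul, mul_comm Complex.I,
      Complex.re_add_im]
  have h1 : τ.IsTraceClass (c.re • T) := by rw [← Complex.coe_smul]; exact hT.smul _
  have h2 : τ.IsTraceClass (c.im • T) := by rw [← Complex.coe_smul]; exact hT.smul _
  rw [e, trace_add h1 (h2.smul _), trace_I_smul, trace_realSmul _ hTN, trace_realSmul _ hTN]
  conv_rhs => rw [← Complex.re_add_im c]
  ring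

theorem trace_neg (hT : τ.IsTraceClass T) : τ.trace (-T) = -τ.trace T := by
  simpa using trace_smul (-1) hT

theorem trace_sub (hS : τ.IsTraceClass S) (hT : τ.IsTraceClass T) :
    τ.trace (S - T) = τ.trace S - τ.trace T := by
  rw [sub_eq_add_neg, trace_add hS hT.neg, trace_neg hT, sub_eq_add_neg]

theorem trace_zero : τ.trace 0 = 0 := by
  simpa using trace_smul 0 (τ := τ) ⟨0, TraceBound.zero⟩

theorem trace_of_nonneg (h : 0 ≤ T) : τ.trace T = (τ.toFun T).toReal := by
  have hsa : IsSelfAdjoint T := .of_nonneg h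
  rw [trace_eq, hsa.coe_realPart, hsa.imaginaryPart]
  simp [saTrace, (CFC.posPart_eq_self T).2 h, (CFC.negPart_eq_zero_iff T hsa).2 h, τ.map_zero]

theorem polarization_left (a b : H →L[ℂ] H) : (4 : ℂ) • (star b * a) =
    (star (a + (1 : ℂ) • b) * (a + (1 : ℂ) • b) - star (a + (-1 : ℂ) • b) * (a + (-1 : ℂ) • b)) +
      Complex.I • (star (a + Complex.I • b) * (a + Complex.I • b) -
        star (a + (-Complex.I) • b) * (a + (-Complex.I) • b)) := by
  simp only [star_add, star_smul, add_mul, mul_add, smul_mul_assoc, mul_smul_comm, RCLike.star_def,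
    map_neg, map_one, Complex.conj_I]
  match_scalars <;> ring_nf <;> simp only [Complex.I_sq] <;> norm_num

theorem polarization_right (a b : H →L[ℂ] H) : (4 : ℂ) • (a * star b) =
    ((a + (1 : ℂ) • b) * star (a + (1 : ℂ) • b) - (a + (-1 : ℂ) • b) * star (a + (-1 : ℂ) • b)) +
      Complex.I • ((a + Complex.I • b) * star (a + Complex.I • b) -
        (a + (-Complex.I) • b) * star (a + (-Complex.I) • b)) := by
  simp only [star_add, star_smul, add_mul, mul_add, smul_mul_assoc, mul_smul_comm, RCLike.star_def,
    map_neg, map_one, Complex.conj_I]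
  match_scalars <;> ring_nf <;> simp only [Complex.I_sq] <;> norm_num

theorem trace_star_mul_self {d : H →L[ℂ] H} (hd : d ∈ N) :
    τ.trace (star d * d) = τ.trace (d * star d) := by
  have h1 : 0 ≤ star d * d := star_mul_self_nonneg d
  have h2 : 0 ≤ d * star d := mul_star_self_nonneg d
  rw [trace_of_nonneg h1, trace_of_nonneg h2, τ.tracial d hd]

/-- Polarization of `τ(d* d) = τ(d d*)` over `d = a + c b` with `c` a fourth root of unity. -/
theorem trace_star_mul_comm {a b : H →L[ℂ] H} (ha : a ∈ N) (hb : b ∈ N)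
    (ha1 : τ.toFun (star a * a) ≠ ∞) (hb1 : τ.toFun (star b * b) ≠ ∞) :
    τ.trace (star b * a) = τ.trace (a * star b) := by
  have hfin : ∀ c : ℂ, τ.IsTraceClass (star (a + c • b) * (a + c • b)) := by
    intro c
    have e : star (a + c • b) * (a + c • b) = star a * a + c • (star a * b) +
        (starRingEnd ℂ c) • (star b * a) + (starRingEnd ℂ c * c) • (star b * b) := by
      simp only [star_add, star_smul, add_mul, mul_add, smul_mul_assoc, mul_smul_comm,
        RCLike.star_def]
      module
    rw [e]
    have haa : τ.IsTraceClass (star a * a) := .star_mul ha ha ha1 ha1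
    have hab : τ.IsTraceClass (star a * b) := .star_mul ha hb ha1 hb1
    have hba : τ.IsTraceClass (star b * a) := .star_mul hb ha hb1 ha1
    have hbb : τ.IsTraceClass (star b * b) := .star_mul hb hb hb1 hb1
    exact ((haa.add (hab.smul _)).add (hba.smul _)).add (hbb.smul _)
  have hN : ∀ c : ℂ, a + c • b ∈ N := fun c => add_mem ha (SMulMemClass.smul_mem c hb)
  have hfin' : ∀ c : ℂ, τ.IsTraceClass ((a + c • b) * star (a + c • b)) := by
    intro c
    refine .of_nonneg (mul_mem (hN c) (star_mem (hN c))) (mul_star_self_nonneg _) ?_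
    rw [← τ.tracial _ (hN c)]
    exact (hfin c).toFun_ne_top (star_mul_self_nonneg _)
  have heq : ∀ c : ℂ, τ.trace (star (a + c • b) * (a + c • b)) =
      τ.trace ((a + c • b) * star (a + c • b)) :=
    fun c => trace_star_mul_self (hN c)
  have p1 := hfin 1
  have p2 := hfin (-1)
  have p3 := hfin Complex.I
  have p4 := hfin (-Complex.I)
  have q1 := hfin' 1
  have q2 := hfin' (-1)
  have q3 := hfin' Complex.I
  have q4 := hfin' (-Complex.I)
  have hba : τ.IsTraceClass (star b * a) := .star_mul hb ha hb1 ha1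
  have hab : τ.IsTraceClass (a * star b) := by
    have h4 : τ.IsTraceClass ((4 : ℂ) • (a * star b)) := by
      rw [polarization_right]
      exact (q1.sub q2).add ((q3.sub q4).smul _)
    have := h4.smul (1 / 4)
    rwa [smul_smul, one_div, inv_mul_cancel₀ (by norm_num), one_smul] at this
  have h4 : (4 : ℂ) * τ.trace (star b * a) = 4 * τ.trace (a * star b) := by
    rw [← trace_smul _ hba, ← trace_smul _ hab, polarization_left, polarization_right,
      trace_add (p1.sub p2) ((p3.sub p4).smul _), trace_add (q1.sub q2) ((q3.sub q4).smul _),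
      trace_smul _ (p3.sub p4), trace_smul _ (q3.sub q4), trace_sub p1 p2, trace_sub p3 p4,
      trace_sub q1 q2, trace_sub q3 q4, heq, heq, heq, heq]
  exact mul_left_cancel₀ (by norm_num) h4

/-- With `r = √T`, both `S r` and `r S` are Hilbert–Schmidt, and both sides equal `τ(r S r)`. -/
theorem trace_mul_comm_of_nonneg (hT : τ.IsTraceClass T) (h0 : 0 ≤ T) (hS : S ∈ N) :
    τ.trace (S * T) = τ.trace (T * S) := by
  have hTN : T ∈ N := hT.choose_spec.1
  have ht := hT.toFun_ne_top h0
  set r := CFC.sqrt T with hr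
  have hrN : r ∈ N := sqrt_mem hTN
  have hs : star r = r := (IsSelfAdjoint.of_nonneg (CFC.sqrt_nonneg T)).star_eq
  have hrr : r * r = T := CFC.sqrt_mul_sqrt_self T
  have hr1 : τ.toFun (star r * r) ≠ ∞ := by rwa [hs, hrr]
  have h1 : τ.toFun (star (S * r) * (S * r)) ≠ ∞ := by
    rw [τ.tracial _ (mul_mem hS hrN)]
    have e : S * r * star (S * r) = S * T * star S := by rw [← hrr]; simp [hs, mul_assoc]
    rw [e]
    refine ne_top_of_le_ne_top ?_ (τ.conj_le (c := ‖S‖₊) hTN hS h0 le_rfl)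
    exact ENNReal.mul_ne_top ENNReal.coe_ne_top ht
  have h2 : τ.toFun (star (r * S) * (r * S)) ≠ ∞ := by
    have e : star (r * S) * (r * S) = star S * T * star (star S) := by
      rw [← hrr]; simp [hs, mul_assoc]
    rw [e]
    refine ne_top_of_le_ne_top ?_
      (τ.conj_le (c := ‖S‖₊) hTN (star_mem hS) h0 (by rw [norm_star]; rfl))
    exact ENNReal.mul_ne_top ENNReal.coe_ne_top ht
  have e1 := trace_star_mul_comm (mul_mem hS hrN) hrN h1 hr1
  have e2 := trace_star_mul_comm (mul_mem hrN hS) hrN h2 hr1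
  simp only [hs, mul_assoc] at e1 e2
  rw [hrr] at e1
  rw [← mul_assoc r r S, hrr] at e2
  rw [← e1, e2]

theorem trace_mul_comm (hT : τ.IsTraceClass T) (hS : S ∈ N) :
    τ.trace (S * T) = τ.trace (T * S) := by
  obtain ⟨C, hT⟩ := hT
  have key : ∀ R : H →L[ℂ] H, τ.SaFinite R → τ.IsTraceClass R ∧
      τ.trace (S * R) = τ.trace (R * S) := by
    rintro R ⟨hR, hsa, hp, hn⟩
    have tp : τ.IsTraceClass R⁺ := .of_nonneg (posPart_mem hR) (CFC.posPart_nonneg R) hp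
    have tn : τ.IsTraceClass R⁻ := .of_nonneg (negPart_mem hR) (CFC.negPart_nonneg R) hn
    have e := CFC.posPart_sub_negPart R hsa
    have h1 : τ.trace (S * (R⁺ - R⁻)) = τ.trace ((R⁺ - R⁻) * S) := by
      rw [mul_sub, sub_mul, trace_sub (tp.mul_left hS) (tn.mul_left hS),
        trace_sub (tp.mul_right hS) (tn.mul_right hS),
        trace_mul_comm_of_nonneg tp (CFC.posPart_nonneg R) hS,
        trace_mul_comm_of_nonneg tn (CFC.negPart_nonneg R) hS]
    rw [e] at h1
    exact ⟨e ▸ tp.sub tn, h1⟩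
  obtain ⟨t1, h1⟩ := key _ hT.saFinite_realPart_le.1
  obtain ⟨t2, h2⟩ := key _ hT.saFinite_imaginaryPart_le.1
  have e := realPart_add_I_smul_imaginaryPart T
  rw [← e, mul_add, add_mul, mul_smul_comm, smul_mul_assoc,
    trace_add (t1.mul_left hS) ((t2.mul_left hS).smul _),
    trace_add (t1.mul_right hS) ((t2.mul_right hS).smul _), trace_smul _ (t2.mul_left hS),
    trace_smul _ (t2.mul_right hS), h1, h2]

end SemifiniteTrace

end BreuerFredholm

end

/-! ### Dyadic truncation as a substitute for Hölder's inequality. -/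

noncomputable section

namespace BreuerFredholm

variable {H : Type*} [NormedAddCommGroup H] [InnerProductSpace ℂ H] [CompleteSpace H]

namespace SemifiniteTrace

variable {N : VonNeumannAlgebra H} (τ : SemifiniteTrace N)

/-- An approximating sequence that interpolates between the operator norm and the trace norm: the
`j`-th term has norm of order `2 ^ (-jk)`, and the differences have trace norm of order
`(β / 2 ^ k) ^ j`. -/
structure IsApprox (β : ℝ≥0) (k : ℕ) (C : ℝ≥0) (Y : ℕ → H →L[ℂ] H) : Prop where
  pos : 0 < C
  mem : ∀ j, Y j ∈ N
  norm_le : ∀ j, ‖Y j‖ ≤ (C * 2⁻¹ ^ (j * k) : ℝ≥0)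
  bound : ∀ j, τ.TraceBound (C * β ^ j * 2⁻¹ ^ (j * k)) (Y j - Y (j + 1))

variable {τ}

theorem IsApprox.one (β : ℝ≥0) : τ.IsApprox β 0 1 fun _ => 1 where
  pos := one_pos
  mem _ := one_mem N
  norm_le j := by
    simp only [mul_zero, pow_zero, mul_one, NNReal.coe_one]
    exact ContinuousLinearMap.norm_id_le
  bound j := by
    rw [sub_self]
    exact TraceBound.zero.mono zero_le

theorem IsApprox.sub {β : ℝ≥0} {k : ℕ} {C C' : ℝ≥0} {Y Z : ℕ → H →L[ℂ] H} (hY : τ.IsApprox β k C Y)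
    (hZ : τ.IsApprox β k C' Z) : τ.IsApprox β k (C + C') fun j => Y j - Z j where
  pos := add_pos hY.pos hZ.pos
  mem j := sub_mem (hY.mem j) (hZ.mem j)
  norm_le j := by
    rw [add_mul]
    exact (norm_sub_le _ _).trans (add_le_add (hY.norm_le j) (hZ.norm_le j))
  bound j := by
    have := (hY.bound j).sub (hZ.bound j)
    rw [← add_mul, ← add_mul] at this
    convert this using 1
    abel

/-- Discrete Leibniz rule: in each of the two terms one factor is a difference with a trace bound
and the other is small in norm. So the norm exponents add while only one power `β ^ j` appears; the
constant `2` counts the terms. -/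
theorem IsApprox.mul {β : ℝ≥0} {k l : ℕ} {C C' : ℝ≥0} {Y Z : ℕ → H →L[ℂ] H} (hY : τ.IsApprox β k C Y)
    (hZ : τ.IsApprox β l C' Z) : τ.IsApprox β (k + l) (2 * C * C') fun j => Y j * Z j where
  pos := mul_pos (mul_pos two_pos hY.pos) hZ.pos
  mem j := mul_mem (hY.mem j) (hZ.mem j)
  norm_le j := by
    refine (norm_mul_le_of_le (hY.norm_le j) (hZ.norm_le j)).trans ?_
    rw [← NNReal.coe_mul, NNReal.coe_le_coe, mul_add, pow_add]
    calc C * 2⁻¹ ^ (j * k) * (C' * 2⁻¹ ^ (j * l))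
        = 1 * (C * C' * (2⁻¹ ^ (j * k) * 2⁻¹ ^ (j * l))) := by ring
      _ ≤ 2 * (C * C' * (2⁻¹ ^ (j * k) * 2⁻¹ ^ (j * l))) := by gcongr; exact one_le_two
      _ = _ := by ring
  bound j := by
    have hone : ‖(1 : H →L[ℂ] H)‖ ≤ (1 : ℝ≥0) := by
      rw [NNReal.coe_one]; exact ContinuousLinearMap.norm_id_le
    have hY0 := hY.pos
    have hZ0 := hZ.pos
    have h1 := (hY.bound j).conj (one_mem N) (hZ.mem j) one_pos
      (by positivity) hone (hZ.norm_le j)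
    have h2 := (hZ.bound j).conj (hY.mem (j + 1)) (one_mem N) (by positivity) one_pos
      (hY.norm_le (j + 1)) hone
    have e : Y j * Z j - Y (j + 1) * Z (j + 1) =
        1 * (Y j - Y (j + 1)) * Z j + Y (j + 1) * (Z j - Z (j + 1)) * 1 := by noncomm_ring
    rw [e]
    refine (h1.add h2).mono ?_
    have h3 : (2⁻¹ : ℝ≥0) ^ ((j + 1) * k) ≤ 2⁻¹ ^ (j * k) := by
      apply pow_le_pow_of_le_one zero_le
      · rw [← NNReal.coe_le_coe]; norm_num
      · exact Nat.mul_le_mul_right k (Nat.le_succ j)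
    calc _ ≤ 1 * (C' * 2⁻¹ ^ (j * l)) * (C * β ^ j * 2⁻¹ ^ (j * k)) +
          C * 2⁻¹ ^ (j * k) * 1 * (C' * β ^ j * 2⁻¹ ^ (j * l)) := by gcongr
      _ = _ := by rw [mul_add, pow_add]; ring

/-- As `k ≠ 0` forces `Y j → 0`, the differences telescope to `Y 0`; their trace bounds form a
geometric series of ratio `β / 2 ^ k`. -/
theorem IsApprox.traceBound {β : ℝ≥0} {k : ℕ} (hk : k ≠ 0) (hβ : β < 2 ^ k) {C : ℝ≥0}
    {Y : ℕ → H →L[ℂ] H} (hY : τ.IsApprox β k C Y) :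
    τ.TraceBound (C * (1 - β * 2⁻¹ ^ k)⁻¹) (Y 0) := by
  have hle : ∀ j : ℕ, (2⁻¹ : ℝ≥0) ^ (j * k) ≤ 2⁻¹ ^ j := by
    intro j
    apply pow_le_pow_of_le_one zero_le
    · rw [← NNReal.coe_le_coe]; norm_num
    · exact Nat.le_mul_of_pos_right j (Nat.pos_of_ne_zero hk)
  have hn : ∀ j, ‖Y j‖ ≤ C * (1 / 2 : ℝ) ^ j := by
    intro j
    refine (hY.norm_le j).trans ?_
    have : (C * 2⁻¹ ^ (j * k) : ℝ≥0) ≤ C * 2⁻¹ ^ j := mul_le_mul' le_rfl (hle j)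
    have := NNReal.coe_le_coe.2 this
    simpa using this
  have hsum : Summable fun j => Y j - Y (j + 1) := by
    refine Summable.of_norm_bounded (g := fun j => C * (1 / 2 : ℝ) ^ j + C * (1 / 2 : ℝ) ^ (j + 1))
      ?_ fun j => (norm_sub_le _ _).trans (add_le_add (hn j) (hn (j + 1)))
    have := summable_geometric_two.mul_left (C : ℝ)
    exact this.add ((summable_nat_add_iff 1).2 this)
  have hlim : Tendsto Y atTop (𝓝 0) := by
    refine squeeze_zero_norm hn ?_
    simpa using (summable_geometric_two.mul_left (C : ℝ)).tendsto_atTop_zero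
  have hS : HasSum (fun j => Y j - Y (j + 1)) (Y 0) := by
    rw [hsum.hasSum_iff_tendsto_nat]
    simp_rw [Finset.sum_range_sub']
    simpa using hlim.const_sub (Y 0)
  have hc : ∀ j : ℕ, C * β ^ j * 2⁻¹ ^ (j * k) = C * (β * 2⁻¹ ^ k) ^ j := by
    intro j
    rw [mul_pow, ← pow_mul, mul_comm k, mul_assoc]
  have hb : ∀ j, τ.TraceBound (C * (β * 2⁻¹ ^ k) ^ j) (Y j - Y (j + 1)) := fun j => by
    rw [← hc j]; exact hY.bound j
  have hr : β * 2⁻¹ ^ k < 1 := by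
    rw [inv_pow, ← div_eq_mul_inv]
    exact (div_lt_one (by positivity)).2 hβ
  have hg : HasSum (fun j : ℕ => C * (β * 2⁻¹ ^ k) ^ j) (C * (1 - β * 2⁻¹ ^ k)⁻¹) :=
    (NNReal.hasSum_geometric hr).mul_left C
  have := TraceBound.hasSum hg.summable hb hS
  rwa [hg.tsum_eq] at this

theorem exists_isApprox_prod {β C : ℝ≥0} (l : List (H →L[ℂ] H))
    (h : ∀ T ∈ l, ∃ Y, Y 0 = T ∧ τ.IsApprox β 1 C Y) :
    ∃ Y, Y 0 = l.prod ∧ τ.IsApprox β l.length ((2 * C) ^ l.length) Y := by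
  induction l with
  | nil => exact ⟨_, rfl, by simpa using IsApprox.one β⟩
  | cons T l ih =>
    obtain ⟨Y, hY0, hY⟩ := h T List.mem_cons_self
    obtain ⟨Z, hZ0, hZ⟩ := ih fun S hS => h S (List.mem_cons_of_mem _ hS)
    refine ⟨fun j => Y j * Z j, by simp [hY0, hZ0], ?_⟩
    have := hY.mul hZ
    rwa [List.length_cons, pow_succ', add_comm]

theorem traceBound_prod {β C : ℝ≥0} (l : List (H →L[ℂ] H)) (hl : l ≠ [])
    (hβ : β < 2 ^ l.length) (h : ∀ T ∈ l, ∃ Y, Y 0 = T ∧ τ.IsApprox β 1 C Y) :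
    τ.TraceBound ((2 * C) ^ l.length * (1 - β * 2⁻¹ ^ l.length)⁻¹) l.prod := by
  obtain ⟨Y, hY0, hY⟩ := exists_isApprox_prod l h
  rw [← hY0]
  exact hY.traceBound (by simpa using hl) hβ

/-- Truncation of the absolute value of `T` at the levels `M / 2 ^ j`. -/
theorem exists_isApprox {p : ℝ} (hp : 0 < p) {M D : ℝ≥0} (hM : 1 ≤ M) {T : H →L[ℂ] H} (hT : T ∈ N)
    (hTM : ‖T‖ ≤ M) (hD : τ.toFun (CFC.abs T ^ p) ≤ D) :
    ∃ Y, Y 0 = T ∧ τ.IsApprox (2 ^ p) 1 (M * 2 ^ p * (D + 1)) Y := by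
  set β : ℝ≥0 := 2 ^ p with hβ
  have hβ1 : 1 ≤ β := NNReal.one_le_rpow one_le_two hp.le
  have hβ0 : 0 < β := one_pos.trans_le hβ1
  have hM0 : 0 < M := one_pos.trans_le hM
  have hM1 : (1 : ℝ) ≤ M := by exact_mod_cast hM
  set m : ℕ → ℝ≥0 := fun j => M * 2⁻¹ ^ j with hm
  have hm0 : ∀ j, (0 : ℝ) < m j := fun j => by
    have : 0 < m j := by rw [hm]; positivity
    exact_mod_cast this
  have hmle : ∀ j, (m (j + 1) : ℝ) ≤ m j := by
    intro j
    rw [NNReal.coe_le_coe]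
    simp only [hm, pow_succ]
    rw [← mul_assoc]
    refine mul_le_of_le_one_right zero_le ?_
    rw [← NNReal.coe_le_coe]; norm_num
  have hmsub : ∀ j, (m j : ℝ) - m (j + 1) = m (j + 1) := by
    intro j
    simp only [hm, pow_succ]
    push_cast
    ring
  have hmax : ∀ j (t : ℝ), 0 < max |t| (m j : ℝ) := fun j t => (hm0 j).trans_le (le_max_right _ _)
  -- On the spectrum `t h(t) = min(t, m j)`, so `T h(|T|)` is `T` with its absolute value truncated
  -- at `m j`.
  set h : ℕ → ℝ → ℝ := fun j t => m j / max |t| (m j : ℝ) with hh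
  have hhc : ∀ j, Continuous (h j) := by
    intro j
    have : ∀ t : ℝ, max |t| (m j : ℝ) ≠ 0 := fun t => (hmax j t).ne'
    fun_prop (disch := assumption)
  have hht : ∀ j t, 0 ≤ t → h j t * t = min t (m j) := by
    intro j t ht
    simp only [hh, abs_of_nonneg ht]
    rcases le_total t (m j) with h1 | h1
    · rw [max_eq_right h1, div_self (hm0 j).ne', one_mul, min_eq_left h1]
    · rw [max_eq_left h1, min_eq_right h1, div_mul_cancel₀]
      exact ((hm0 j).trans_le h1).ne'
  have hh0 : ∀ j t, 0 ≤ h j t := fun j t => div_nonneg (hm0 j).le (hmax j t).le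
  have hTa := CFC.abs_nonneg T
  have hTsa : IsSelfAdjoint (CFC.abs T) := .of_nonneg hTa
  have hTN := abs_mem hT
  refine ⟨fun j => T * cfc (h j) (CFC.abs T), ?_, ?_, fun j => mul_mem hT (cfc_mem_vN _ hTN),
    fun j => ?_, fun j => ?_⟩
  · have : cfc (h 0) (CFC.abs T) = 1 := by
      rw [← cfc_const_one ℝ (CFC.abs T)]
      refine cfc_congr fun t ht => ?_
      obtain ⟨ht0, ht1⟩ := mem_spectrum_abs ht
      have : |t| ≤ (m 0 : ℝ) := by rw [abs_of_nonneg ht0]; simpa [hm] using ht1.trans hTM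
      simp only [hh]
      rw [max_eq_right this, div_self (hm0 0).ne']
    simp only [this, mul_one]
  · positivity
  · refine (norm_mul_cfc_abs_le T _ (hhc j) (m j).coe_nonneg fun t ht _ => ?_).trans ?_
    · rw [abs_of_nonneg (hh0 j t), hht j t ht]
      exact min_le_right _ _
    · rw [NNReal.coe_le_coe, mul_one]
      simp only [hm]
      gcongr
      rw [mul_assoc]
      refine le_mul_of_one_le_right zero_le (one_le_mul hβ1 le_add_self)
  -- The difference of two truncations has absolute value `w(|T|)`. It is split as `V K` with `V* V
  -- = K* K = w(|T|)`, so that `TraceBound.factor` applies.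
  · set w : ℝ → ℝ := fun t => min |t| (m j) - min |t| (m (j + 1)) with hw
    have hw0 : ∀ t, 0 ≤ w t := fun t => sub_nonneg.2 (min_le_min le_rfl (hmle j))
    have hwz : ∀ t : ℝ, |t| ≤ m (j + 1) → w t = 0 := by
      intro t ht
      simp only [hw]
      rw [min_eq_left ht, min_eq_left (ht.trans (hmle j)), sub_self]
    have hwm : ∀ t, w t ≤ m (j + 1) := by
      intro t
      rcases le_total |t| (m (j + 1)) with h1 | h1
      · rw [hwz t h1]; exact (hm0 _).le
      · simp only [hw]
        rw [min_eq_right h1]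
        linarith [min_le_right |t| (m j : ℝ), hmsub j]
    have hwc : Continuous w := by fun_prop
    set k : ℝ → ℝ := fun t => Real.sqrt (w t) with hk
    have hkc : Continuous k := by fun_prop
    have hkk : ∀ t, k t * k t = w t := fun t => Real.mul_self_sqrt (hw0 t)
    have hkm : ∀ t, k t ≤ Real.sqrt (m (j + 1)) := fun t => Real.sqrt_le_sqrt (hwm t)
    set v : ℝ → ℝ := fun t => k t / max |t| (m (j + 1) : ℝ) with hv
    have hvc : Continuous v := by
      have : ∀ t : ℝ, max |t| (m (j + 1) : ℝ) ≠ 0 := fun t => (hmax _ t).ne'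
      fun_prop (disch := assumption)
    have hvt : ∀ t, 0 ≤ t → v t * t = k t := by
      intro t ht
      simp only [hv]
      rcases le_total |t| (m (j + 1)) with h1 | h1
      · simp [hk, hwz t h1]
      · rw [max_eq_left h1, abs_of_nonneg ht, div_mul_cancel₀]
        rw [abs_of_nonneg ht] at h1
        exact ((hm0 _).trans_le h1).ne'
    have hvk : ∀ t, 0 ≤ t → v t * k t = h j t - h (j + 1) t := by
      intro t ht
      rcases ht.eq_or_lt with rfl | ht'
      · simp only [hh, hk, hwz 0 (by simp), abs_zero, Real.sqrt_zero, mul_zero]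
        rw [max_eq_right (hm0 j).le, max_eq_right (hm0 (j + 1)).le, div_self (hm0 j).ne',
          div_self (hm0 (j + 1)).ne', sub_self]
      · refine mul_right_cancel₀ ht'.ne' ?_
        rw [mul_right_comm, hvt t ht, hkk, sub_mul, hht j t ht, hht (j + 1) t ht]
        simp only [hw, abs_of_nonneg ht]
    set V := T * cfc v (CFC.abs T) with hV
    set K := cfc k (CFC.abs T) with hK
    have hVN : V ∈ N := mul_mem hT (cfc_mem_vN _ hTN)
    have hKN : K ∈ N := cfc_mem_vN _ hTN
    have eVK : T * cfc (h j) (CFC.abs T) - T * cfc (h (j + 1)) (CFC.abs T) = V * K := by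
      rw [hV, hK, mul_assoc, ← mul_sub, ← cfc_mul v k _ (by fun_prop) (by fun_prop),
        ← cfc_sub (h j) (h (j + 1)) _ (by fun_prop) (by fun_prop)]
      congr 1
      exact cfc_congr fun t ht => (hvk t (mem_spectrum_abs ht).1).symm
    have eVV : star V * V = cfc w (CFC.abs T) := by
      rw [hV, star_mul_cfc_abs T v v hvc hvc]
      refine cfc_congr fun t ht => ?_
      have := hvt t (mem_spectrum_abs ht).1
      calc v t * t ^ 2 * v t = (v t * t) * (v t * t) := by ring
        _ = w t := by rw [this, hkk]
    have eKK : star K * K = cfc w (CFC.abs T) := by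
      have : star K = K := (cfc_predicate k (CFC.abs T) : IsSelfAdjoint _).star_eq
      rw [this, hK, ← cfc_mul k k _ (by fun_prop) (by fun_prop)]
      simp only [hkk]
    have nV : ‖V‖ ≤ Real.sqrt (m (j + 1)) := by
      refine norm_mul_cfc_abs_le T v hvc (Real.sqrt_nonneg _) fun t ht _ => ?_
      rw [← abs_of_nonneg ht, ← abs_mul, abs_of_nonneg ht, hvt t ht,
        abs_of_nonneg (Real.sqrt_nonneg _)]
      exact hkm t
    have nK : ‖K‖ ≤ Real.sqrt (m (j + 1)) := by
      refine norm_cfc_le (Real.sqrt_nonneg _) fun t _ => ?_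
      rw [Real.norm_of_nonneg (Real.sqrt_nonneg _)]
      exact hkm t
    have hsq : ∀ r : ℝ, 0 ≤ r → r ≤ Real.sqrt (m (j + 1)) → r ^ 2 ≤ m (j + 1) := by
      intro r hr0 hr
      calc r ^ 2 ≤ Real.sqrt (m (j + 1)) ^ 2 := by gcongr
        _ = _ := Real.sq_sqrt (hm0 _).le
    set c : ℝ≥0 := M * β * β ^ j * 2⁻¹ ^ j with hc
    have hmc : m (j + 1) ≤ c := by
      calc m (j + 1) ≤ m j := hmle j
        _ = M * 1 * 1 * 2⁻¹ ^ j := by simp [hm]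
        _ ≤ c := by
            rw [hc]; gcongr; exact one_le_pow₀ hβ1
    have hcont : Continuous fun t : ℝ => t ^ p := Real.continuous_rpow_const hp.le
    have hβinv : ((2⁻¹ : ℝ) ^ (j + 1)) ^ p = (β : ℝ)⁻¹ ^ (j + 1) := by
      have : (β : ℝ) = 2 ^ p := by rw [hβ, NNReal.coe_rpow]; rfl
      rw [this, ← Real.inv_rpow zero_le_two, ← Real.rpow_natCast, ← Real.rpow_natCast,
        ← Real.rpow_mul (by norm_num), ← Real.rpow_mul (by norm_num), mul_comm]
    -- A Chebyshev estimate: `w` vanishes below `m (j + 1)`, and above it `t ≥ 2^{-(j + 1)}` since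
    -- `M ≥ 1`, so `t ^ p ≥ β^{-(j + 1)}`.
    have hwt : ∀ t, 0 ≤ t → w t ≤ c * t ^ p := by
      intro t ht
      rcases le_total |t| (m (j + 1)) with h1 | h1
      · rw [hwz t h1]; positivity
      · rw [abs_of_nonneg ht] at h1
        have h2 : (2⁻¹ : ℝ) ^ (j + 1) ≤ t := by
          refine le_trans ?_ h1
          simp only [hm]
          push_cast
          exact le_mul_of_one_le_left (by positivity) hM1
        have h3 : (β : ℝ)⁻¹ ^ (j + 1) ≤ t ^ p := by
          rw [← hβinv]
          exact Real.rpow_le_rpow (by positivity) h2 hp.le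
        calc w t ≤ m (j + 1) := hwm t
          _ = M * 2⁻¹ ^ (j + 1) := by simp [hm]
          _ ≤ M * 2⁻¹ ^ j := by
              gcongr ?_ * ?_
              exact pow_le_pow_of_le_one (by norm_num) (by norm_num) (Nat.le_succ j)
          _ = c * (β : ℝ)⁻¹ ^ (j + 1) := by
              have hβ' : (β : ℝ) ≠ 0 := by exact_mod_cast hβ0.ne'
              rw [hc]
              push_cast
              rw [inv_pow (β : ℝ), pow_succ]
              field_simp
          _ ≤ c * t ^ p := by gcongr
    have htr : τ.toFun (cfc w (CFC.abs T)) ≤ (c * D : ℝ≥0) := by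
      have hp0 : 0 ≤ CFC.abs T ^ p := CFC.rpow_nonneg
      have hpN : CFC.abs T ^ p ∈ N := by
        rw [CFC.rpow_eq_cfc_real hTa]
        exact cfc_mem_vN _ hTN
      have hle : cfc w (CFC.abs T) ≤ (c : ℝ) • CFC.abs T ^ p := by
        rw [CFC.rpow_eq_cfc_real hTa, ← cfc_const_mul (c : ℝ) (fun t : ℝ => t ^ p) _ (by fun_prop)]
        exact cfc_mono (fun t ht => hwt t (mem_spectrum_abs ht).1) (by fun_prop) (by fun_prop)
      refine (τ.mono (cfc_mem_vN _ hTN) (realSmul_mem _ hpN) (cfc_nonneg fun t _ => hw0 t)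
        hle).trans ?_
      rw [τ.map_realSmul c hpN hp0, ENNReal.coe_mul]
      exact mul_le_mul' le_rfl hD
    -- The summand `c * D` pays for the traces, the extra `c` for the norms.
    have hcC : M * β * (D + 1) * β ^ j * 2⁻¹ ^ (j * 1) = c * D + c := by
      rw [hc, mul_one]; ring
    rw [eVK, hcC]
    have b1 : (m (j + 1) : ℝ) ≤ (c * D + c : ℝ≥0) := by
      rw [NNReal.coe_le_coe]; exact hmc.trans le_add_self
    have b2 : ((c * D : ℝ≥0) : ℝ≥0∞) ≤ (c * D + c : ℝ≥0) := by
      rw [ENNReal.coe_le_coe]; exact le_self_add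
    refine TraceBound.factor hVN hKN ((hsq _ (norm_nonneg _) nV).trans b1)
      ((hsq _ (norm_nonneg _) nK).trans b1) ?_ ?_
    · rw [eVV]; exact htr.trans b2
    · rw [eKK]; exact htr.trans b2

theorem IsSummable.toFun_rpow_ne_top {p : ℝ} (hp : 0 < p) {T : H →L[ℂ] H}
    (h : τ.IsSummable p T) : τ.toFun (CFC.abs T ^ p) ≠ ∞ := by
  intro h'
  have := h.2
  rw [pNorm, h', ENNReal.top_rpow_of_pos (by positivity)] at this
  exact lt_irrefl _ this

theorem continuous_abs_rpow {p : ℝ} (hp : 0 < p) :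
    Continuous fun T : H →L[ℂ] H => CFC.abs T ^ p :=
  Continuous.cfc_nnreal_of_mem_nhdsSet (s := Set.univ) (fun t : ℝ≥0 => t ^ p) Filter.univ_mem
    CFC.continuous_abs (fun T => CFC.abs_nonneg T) (NNReal.continuous_rpow_const hp.le).continuousOn

end SemifiniteTrace

end BreuerFredholm

end

/-! ### Summability of commutator products and continuity of the cochains. -/

noncomputable section

namespace BreuerFredholm

variable {A : Type*} [NormedRing A] [NormedAlgebra ℂ A]
  {H : Type*} [NormedAddCommGroup H] [InnerProductSpace ℂ H] [CompleteSpace H]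

/-- Homogeneity spreads the trace bound from the polydisc to all arguments. The trace is at most `2
C` there, and on the shell `δ / 2 ≤ ‖m i‖ < δ` the factor `(2 / δ) ^ k` turns this into an estimate
by the product of the norms. -/
theorem SemifiniteTrace.exists_continuousMultilinearMap {N : VonNeumannAlgebra H}
    {τ : SemifiniteTrace N} {k : ℕ} (Φ : MultilinearMap ℂ (fun _ : Fin k => A) (H →L[ℂ] H))
    {δ : ℝ} (hδ : 0 < δ) {C : ℝ≥0}
    (h : ∀ a : Fin k → A, (∀ i, ‖a i‖ < δ) → τ.TraceBound C (Φ a)) :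
    (∀ a, τ.IsTraceClass (Φ a)) ∧
      ∃ f : ContinuousMultilinearMap ℂ (fun _ : Fin k => A) ℂ, ∀ a, f a = τ.trace (Φ a) := by
  have htc : ∀ a, τ.IsTraceClass (Φ a) := by
    intro a
    have hS : 0 < 1 + ∑ i, ‖a i‖ := by positivity
    set c : ℝ := δ / (1 + ∑ i, ‖a i‖) with hc
    have hc0 : 0 < c := div_pos hδ hS
    have hcC : (c : ℂ) ≠ 0 := by exact_mod_cast hc0.ne'
    have h1 := h (fun i => (c : ℂ) • a i) fun i => by
      rw [norm_smul, Complex.norm_real, Real.norm_of_nonneg hc0.le, hc, div_mul_eq_mul_div,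
        div_lt_iff₀ hS]
      refine mul_lt_mul_of_pos_left ?_ hδ
      have := Finset.single_le_sum (f := fun i => ‖a i‖) (fun i _ => norm_nonneg _)
        (Finset.mem_univ i)
      linarith
    rw [Φ.map_smul_univ (fun _ => (c : ℂ)) a, Finset.prod_const] at h1
    have h2 := h1.smul ((c : ℂ) ^ (Finset.univ : Finset (Fin k)).card)⁻¹
    rw [smul_smul, inv_mul_cancel₀ (pow_ne_zero _ hcC), one_smul] at h2
    exact ⟨_, h2⟩
  refine ⟨htc, ?_⟩
  let f : MultilinearMap ℂ (fun _ : Fin k => A) ℂ :=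
    { toFun := fun a => τ.trace (Φ a)
      map_update_add' := fun a i x y => by
        rw [Φ.map_update_add, SemifiniteTrace.trace_add (htc _) (htc _)]
      map_update_smul' := fun a i c x => by
        rw [Φ.map_update_smul, SemifiniteTrace.trace_smul c (htc _), smul_eq_mul] }
  refine ⟨f.mkContinuous (2 * C * (2 / δ) ^ k) (f.bound_of_shell (ε := fun _ => δ)
    (c := fun _ => (2 : ℂ)) (fun _ => hδ) (fun _ => by simp) fun m hm1 hm2 => ?_), fun a => rfl⟩
  refine (h m hm2).norm_trace_le.trans ?_
  rw [mul_assoc (2 * (C : ℝ))]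
  refine le_mul_of_one_le_right (by positivity) ?_
  have : (2 / δ) ^ k = ∏ _i : Fin k, (2 / δ) := by
    rw [Finset.prod_const, Finset.card_univ, Fintype.card_fin]
  rw [this, ← Finset.prod_mul_distrib]
  rw [← Finset.prod_const_one (s := (Finset.univ : Finset (Fin k)))]
  refine Finset.prod_le_prod (fun _ _ => zero_le_one) fun i _ => ?_
  have h1 := hm1 i
  simp only [Complex.norm_ofNat] at h1
  calc (1 : ℝ) = 2 / δ * (δ / 2) := by field_simp
    _ ≤ 2 / δ * ‖m i‖ := by gcongr

namespace OddModule

variable [StarRing A] (M : OddModule A H)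

theorem comm_mem (a : A) : M.comm a ∈ M.N :=
  sub_mem (mul_mem M.F_mem (M.ρ_mem a)) (mul_mem (M.ρ_mem a) M.F_mem)

theorem continuous_comm : Continuous M.comm := by
  have := M.ρ_continuous
  unfold comm
  fun_prop

/-- The derivation `a ↦ [F, ρ(a)]` as a linear map. -/
def commHom : A →ₗ[ℂ] (H →L[ℂ] H) where
  toFun := M.comm
  map_add' a b := by simp only [comm, map_add, mul_add, add_mul]; abel
  map_smul' c a := by
    simp only [comm, map_smul, mul_smul_comm, smul_mul_assoc, RingHom.id_apply, smul_sub]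

@[simp]
theorem commHom_apply (a : A) : M.commHom a = M.comm a := rfl

theorem comm_one : M.comm 1 = 0 := by simp [comm]

theorem comm_mul (a b : A) : M.comm (a * b) = M.comm a * M.ρ b + M.ρ a * M.comm b := by
  simp only [comm, map_mul]
  noncomm_ring

theorem commProd_succ {k : ℕ} (a : Fin (k + 1) → A) :
    M.commProd a = M.comm (a 0) * M.commProd (Fin.tail a) := by
  rw [commProd, List.ofFn_succ, List.prod_cons]
  rfl

theorem commProd_succ_last {k : ℕ} (a : Fin (k + 1) → A) :
    M.commProd a = M.commProd (Fin.init a) * M.comm (a (Fin.last k)) := by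
  rw [commProd, List.ofFn_succ_last, List.prod_append, List.prod_singleton]
  rfl

theorem commProd_eq_zero {k : ℕ} (a : Fin k → A) (i : Fin k) (h : a i = 1) :
    M.commProd a = 0 :=
  List.prod_eq_zero (List.mem_ofFn.2 ⟨i, by rw [h, comm_one]⟩)

/-- A multilinear map with values in the operators: the product of `L (a 0)` and the commutators
with the other variables. -/
def consProd (L : A →ₗ[ℂ] (H →L[ℂ] H)) (k : ℕ) :
    MultilinearMap ℂ (fun _ : Fin (k + 1) => A) (H →L[ℂ] H) :=
  (MultilinearMap.mkPiAlgebraFin ℂ (k + 1) (H →L[ℂ] H)).compLinearMap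
    (Fin.cons (α := fun _ => A →ₗ[ℂ] (H →L[ℂ] H)) L fun _ => M.commHom)

theorem consProd_apply (L : A →ₗ[ℂ] (H →L[ℂ] H)) (k : ℕ) (a : Fin (k + 1) → A) :
    M.consProd L k a = L (a 0) * M.commProd (Fin.tail a) := by
  rw [consProd, MultilinearMap.compLinearMap_apply, MultilinearMap.mkPiAlgebraFin_apply,
    List.ofFn_succ, List.prod_cons]
  rfl

section Summable

variable [CompleteSpace A] {M} {p : ℝ}

/-- By the Baire category theorem, the `p`-summability of the commutators is uniform on some
ball. -/
theorem IsPSummable.exists_isApprox (hp : 0 < p) (h : M.IsPSummable p) : ∃ δ > 0, ∃ C : ℝ≥0,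
    ∀ b : A, ‖b‖ < δ → ∃ Y, Y 0 = M.comm b ∧ M.τ.IsApprox (2 ^ p) 1 C Y := by
  set E : ℕ → Set A := fun m => {a | M.τ.toFun (CFC.abs (M.comm a) ^ p) ≤ m} with hE
  have hcl : ∀ m, IsClosed (E m) := by
    intro m
    refine IsSeqClosed.isClosed fun u a hu hua => ?_
    have hN : ∀ k, CFC.abs (M.comm (u k)) ^ p ∈ M.N := by
      intro k
      rw [CFC.rpow_eq_cfc_real (CFC.abs_nonneg _)]
      exact cfc_mem_vN _ (abs_mem (M.comm_mem _))
    -- Lower semicontinuity of `τ`, together with norm continuity of `a ↦ |[F, a]|^p`, closes the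
    -- Baire sets.
    refine M.τ.le_of_tendsto hN (fun k => CFC.rpow_nonneg) ?_ hu
    exact (((SemifiniteTrace.continuous_abs_rpow hp).comp M.continuous_comm).tendsto a).comp hua
  have hU : ⋃ m, E m = Set.univ := by
    refine Set.eq_univ_of_forall fun a => Set.mem_iUnion.2 ?_
    obtain ⟨m, hm⟩ := ENNReal.exists_nat_gt ((h a).toFun_rpow_ne_top hp)
    exact ⟨m, hm.le⟩
  obtain ⟨m, a₀, ha₀⟩ := nonempty_interior_of_iUnion_of_closed hcl hU
  have h1 : ∀ᶠ a in 𝓝 a₀, a ∈ E m ∧ ‖M.comm a‖ < ‖M.comm a₀‖ + 1 :=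
    Filter.Eventually.and (mem_interior_iff_mem_nhds.1 ha₀)
      (M.continuous_comm.norm.continuousAt.eventually_lt continuousAt_const (by simp))
  obtain ⟨δ, hδ, hball⟩ := Metric.eventually_nhds_iff.1 h1
  set K : ℝ≥0 := ‖M.comm a₀‖₊ + 1
  have key : ∀ a, dist a a₀ < δ → ∃ Y, Y 0 = M.comm a ∧
      M.τ.IsApprox (2 ^ p) 1 (K * 2 ^ p * ((m : ℝ≥0) + 1)) Y := by
    intro a ha
    obtain ⟨h2, h3⟩ := hball ha
    refine SemifiniteTrace.exists_isApprox hp le_add_self (M.comm_mem a) ?_ ?_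
    · push_cast; exact h3.le
    · simpa [hE] using h2
  -- The ball is moved to the origin by `[F, b] = [F, a₀ + b] - [F, a₀]`. Subtracting approximating
  -- sequences needs no triangle inequality for the `p`-norm, which would fail in this form for `p <
  -- 1`.
  refine ⟨δ, hδ, K * 2 ^ p * ((m : ℝ≥0) + 1) + K * 2 ^ p * ((m : ℝ≥0) + 1), fun b hb => ?_⟩
  obtain ⟨Y, hY0, hY⟩ := key (a₀ + b) (by simpa [dist_eq_norm] using hb)
  obtain ⟨Z, hZ0, hZ⟩ := key a₀ (by simpa using hδ)
  refine ⟨fun j => Y j - Z j, ?_, hY.sub hZ⟩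
  simp only [hY0, hZ0]
  rw [← commHom_apply, map_add, commHom_apply, commHom_apply, add_sub_cancel_left]

theorem IsPSummable.exists_traceBound (hp : 0 < p) (h : M.IsPSummable p) {k : ℕ} (hk : p < k) :
    ∃ δ > 0, ∃ C : ℝ≥0, ∀ a : Fin k → A, (∀ i, ‖a i‖ < δ) → M.τ.TraceBound C (M.commProd a) := by
  obtain ⟨δ, hδ, C, hC⟩ := h.exists_isApprox hp
  refine ⟨δ, hδ, (2 * C) ^ k * (1 - 2 ^ p * 2⁻¹ ^ k)⁻¹, fun a ha => ?_⟩
  have hk0 : k ≠ 0 := by rintro rfl; simp at hk; linarith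
  have hlen : (List.ofFn fun i => M.comm (a i)).length = k := List.length_ofFn
  have := SemifiniteTrace.traceBound_prod (τ := M.τ) (β := 2 ^ p) (C := C)
    (List.ofFn fun i => M.comm (a i)) (by simpa using hk0) ?_ ?_
  · rw [hlen] at this
    exact this
  · rw [hlen, ← NNReal.rpow_natCast]
    exact NNReal.rpow_lt_rpow_of_exponent_lt one_lt_two hk
  · intro T hT
    obtain ⟨i, rfl⟩ := List.mem_ofFn.1 hT
    exact hC _ (ha i)

/-- The variable `a 0` enters only through a bounded operator, so the `k` remaining commutators
suffice. Both cochains have this shape: for `ch^n` the factor `[F, a₀]` goes into `L`, which leaves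
`n > p` commutators. -/
theorem IsPSummable.exists_continuousMultilinearMap_consProd (hp : 0 < p) (h : M.IsPSummable p)
    {k : ℕ} (hk : p < k) (L : A →ₗ[ℂ] (H →L[ℂ] H)) (hL : Continuous L) (hLN : ∀ a, L a ∈ M.N) :
    (∀ a : Fin (k + 1) → A, M.τ.IsTraceClass (L (a 0) * M.commProd (Fin.tail a))) ∧
      ∃ f : ContinuousMultilinearMap ℂ (fun _ : Fin (k + 1) => A) ℂ,
        ∀ a, f a = M.τ.trace (L (a 0) * M.commProd (Fin.tail a)) := by
  obtain ⟨δ, hδ, C, hC⟩ := h.exists_traceBound hp hk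
  have h1 : ∀ᶠ a in 𝓝 (0 : A), ‖L a‖ < 1 :=
    hL.norm.continuousAt.eventually_lt continuousAt_const (by simp)
  obtain ⟨δ', hδ', hball⟩ := Metric.eventually_nhds_iff.1 h1
  have hone : ‖(1 : H →L[ℂ] H)‖ ≤ (1 : ℝ≥0) := by
    rw [NNReal.coe_one]; exact ContinuousLinearMap.norm_id_le
  have := SemifiniteTrace.exists_continuousMultilinearMap (τ := M.τ) (M.consProd L k)
    (lt_min hδ hδ') (C := C) fun a ha => ?_
  · simpa only [consProd_apply] using this
  · rw [consProd_apply]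
    have h2 := hC (Fin.tail a) fun i => (ha i.succ).trans_le (min_le_left _ _)
    have h3 : ‖L (a 0)‖ < 1 := hball (by simpa using (ha 0).trans_le (min_le_right _ _))
    simpa using h2.conj (hLN (a 0)) (one_mem M.N) one_pos one_pos (by simpa using h3.le) hone

theorem IsPSummable.isTraceClass_commProd (hp : 0 < p) (h : M.IsPSummable p) {k : ℕ}
    (hk : p < k) (a : Fin k → A) : M.τ.IsTraceClass (M.commProd a) := by
  obtain ⟨δ, hδ, C, hC⟩ := h.exists_traceBound hp hk
  have := (SemifiniteTrace.exists_continuousMultilinearMap (τ := M.τ)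
    ((MultilinearMap.mkPiAlgebraFin ℂ k (H →L[ℂ] H)).compLinearMap fun _ => M.commHom) hδ hC).1 a
  exact this

end Summable

end OddModule

theorem entireGrowth_single {n : ℕ} (f : (Fin (n + 1) → A) → ℂ) :
    EntireGrowth (Pi.single n f : Family A) := by
  intro z
  refine summable_of_ne_finset_zero (s := {n}) fun k hk => ?_
  rw [Pi.single_eq_of_ne (by simpa using hk), cochainNorm_zero]
  simp

theorem single_mem_entireCochains {n : ℕ} {f : (Fin (n + 1) → A) → ℂ} (hf : IsCochain n f)
    {ε : ZMod 2} (hε : (n : ZMod 2) = ε) : (Pi.single n f : Family A) ∈ entireCochains A ε := by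
  refine ⟨fun k => ?_, entireGrowth_single f, fun k hk => ?_⟩
  · rcases eq_or_ne k n with rfl | h
    · rwa [Pi.single_eq_same]
    · rw [Pi.single_eq_of_ne h]
      exact IsCochain.zero k
  · refine Pi.single_eq_of_ne ?_ _
    rintro rfl
    exact hk hε

namespace OddModule

variable [StarRing A] [CompleteSpace A] {M : OddModule A H} {p : ℝ} {γ : H →L[ℂ] H} {n : ℕ}

theorem IsPSummable.isTraceClass_mul_commProd (hp : 0 < p) (h : M.IsPSummable p) {k : ℕ}
    (hk : p < k) {S : H →L[ℂ] H} (hS : S ∈ M.N) (a : Fin k → A) :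
    M.τ.IsTraceClass (S * M.commProd a) :=
  (h.isTraceClass_commProd hp hk a).mul_left hS

theorem IsPSummable.isTraceClass_chOp (hp : 0 < p) (h : M.IsPSummable p) (hn : p < n)
    (hγ : γ ∈ M.N) (a : Fin (n + 1) → A) : M.τ.IsTraceClass (M.chOp γ a) :=
  h.isTraceClass_mul_commProd hp (hn.trans (by simp)) (mul_mem hγ M.F_mem) a

theorem IsPSummable.isTraceClass_psiOp (hp : 0 < p) (h : M.IsPSummable p) (hn : p < n)
    (hγ : γ ∈ M.N) (a : Fin (n + 2) → A) : M.τ.IsTraceClass (M.psiOp γ a) :=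
  h.isTraceClass_mul_commProd hp (hn.trans (by simp))
    (mul_mem (mul_mem hγ (M.ρ_mem _)) M.F_mem) _

theorem IsPSummable.chWith_mem (hp : 0 < p) (h : M.IsPSummable p) (hn : p < n)
    (hγ : γ ∈ M.N) {ε : ZMod 2} (hε : (n : ZMod 2) = ε) :
    M.chWith γ n ∈ entireCochains A ε := by
  refine single_mem_entireCochains (IsCochain.smul _ ⟨?_, fun a i _ hi => ?_⟩) hε
  · obtain ⟨-, f, hf⟩ := h.exists_continuousMultilinearMap_consProd hp hn
      (LinearMap.mulLeft ℂ (γ * M.F) ∘ₗ M.commHom)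
      (continuous_const.mul M.continuous_comm)
      (fun a => mul_mem (mul_mem hγ M.F_mem) (M.comm_mem a))
    refine ⟨f, fun a => ?_⟩
    rw [hf, chOp, commProd_succ, ← mul_assoc]
    rfl
  · rw [chOp, M.commProd_eq_zero a i hi, mul_zero, SemifiniteTrace.trace_zero]

theorem IsPSummable.psiWith_mem (hp : 0 < p) (h : M.IsPSummable p) (hn : p < n)
    (hγ : γ ∈ M.N) {ε : ZMod 2} (hε : ((n + 1 : ℕ) : ZMod 2) = ε) :
    M.psiWith γ n ∈ entireCochains A ε := by
  refine single_mem_entireCochains (IsCochain.smul _ ⟨?_, fun a i hi0 hi => ?_⟩) hε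
  · obtain ⟨-, f, hf⟩ := h.exists_continuousMultilinearMap_consProd hp
      (hn.trans (by simp : (n : ℝ) < ((n + 1 : ℕ) : ℝ)))
      (LinearMap.mulRight ℂ M.F ∘ₗ LinearMap.mulLeft ℂ γ ∘ₗ M.ρ.toAlgHom.toLinearMap)
      ((continuous_const.mul M.ρ_continuous).mul continuous_const)
      (fun a => mul_mem (mul_mem hγ (M.ρ_mem a)) M.F_mem)
    exact ⟨f, fun a => hf a⟩
  · obtain ⟨j, rfl⟩ := Fin.exists_succ_eq.2 hi0
    rw [psiOp, M.commProd_eq_zero (Fin.tail a) j hi, mul_zero, SemifiniteTrace.trace_zero]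

end OddModule

end BreuerFredholm

end

/-! ### The cyclic identities and the transgression formula. -/

noncomputable section

namespace BreuerFredholm

theorem contractNth_succ_eq_cons {R : Type*} [Mul R] {k : ℕ} (i : Fin (k + 2))
    (a : Fin (k + 3) → R) :
    Fin.contractNth i.succ (· * ·) a =
      Fin.cons (a 0) (Fin.contractNth i (· * ·) (Fin.tail a)) := by
  funext j
  refine Fin.cases ?_ (fun j => ?_) j
  · rw [Fin.contractNth_apply_of_lt _ _ _ _ (by simp)]
    rfl
  · rw [Fin.cons_succ]
    rcases lt_trichotomy (j : ℕ) i with h | h | h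
    · rw [Fin.contractNth_apply_of_lt _ _ _ _ h,
        Fin.contractNth_apply_of_lt _ _ _ _ (by simpa using h)]
      rfl
    · rw [Fin.contractNth_apply_of_eq _ _ _ _ h,
        Fin.contractNth_apply_of_eq _ _ _ _ (by simpa using h)]
      rfl
    · rw [Fin.contractNth_apply_of_gt _ _ _ _ h,
        Fin.contractNth_apply_of_gt _ _ _ _ (by simpa using h)]
      rfl

theorem contractNth_zero_eq_cons {R : Type*} [Mul R] {k : ℕ} (a : Fin (k + 2) → R) :
    Fin.contractNth 0 (· * ·) a = Fin.cons (a 0 * a 1) (Fin.tail (Fin.tail a)) := by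
  funext j
  refine Fin.cases ?_ (fun j => ?_) j
  · rw [Fin.contractNth_apply_of_eq _ _ _ _ (by simp)]
    rfl
  · rw [Fin.contractNth_apply_of_gt _ _ _ _ (by simp)]
    rfl

variable {A : Type*} [NormedRing A] [NormedAlgebra ℂ A]
  {H : Type*} [NormedAddCommGroup H] [InnerProductSpace ℂ H] [CompleteSpace H]

namespace OddModule

variable [StarRing A] (M : OddModule A H)

theorem F_mul_comm (a : A) : M.F * M.comm a = -(M.comm a * M.F) := by
  have h : ∀ X : H →L[ℂ] H, M.F * (M.F * X) = X := fun X => by rw [← mul_assoc, M.F_sq, one_mul]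
  simp only [comm, mul_sub, sub_mul, mul_assoc, h, M.F_sq, mul_one]
  abel

theorem F_mul_commProd {k : ℕ} (a : Fin k → A) :
    M.F * M.commProd a = (-1 : ℂ) ^ k • (M.commProd a * M.F) := by
  induction k with
  | zero => simp [commProd]
  | succ k ih =>
    rw [commProd_succ, ← mul_assoc, F_mul_comm, neg_mul, mul_assoc, ih, mul_smul_comm, pow_succ',
      mul_smul, neg_one_smul, mul_assoc]

/-- The derivation property, summed with alternating signs. -/
theorem sum_commProd_contractNth {k : ℕ} (a : Fin (k + 2) → A) :
    ∑ j : Fin (k + 1), (-1 : ℂ) ^ (j : ℕ) •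
        M.commProd (Fin.contractNth j.castSucc (· * ·) a) =
      M.ρ (a 0) * M.commProd (Fin.tail a) +
        (-1 : ℂ) ^ k • (M.commProd (Fin.init a) * M.ρ (a (Fin.last (k + 1)))) := by
  induction k with
  | zero =>
    simp only [Fin.sum_univ_succ, Finset.univ_eq_empty, Finset.sum_empty, add_zero]
    simp only [Fin.val_zero, pow_zero, one_smul, Fin.castSucc_zero, contractNth_zero_eq_cons,
      commProd_succ, Fin.cons_zero, comm_mul]
    simp [commProd, Fin.tail, Fin.init, add_comm]
  | succ k ih =>
    rw [Fin.sum_univ_succ]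
    have h1 : ∀ j : Fin (k + 1), (-1 : ℂ) ^ (j.succ : ℕ) •
        M.commProd (Fin.contractNth j.succ.castSucc (· * ·) a) =
        -(M.comm (a 0) * ((-1 : ℂ) ^ (j : ℕ) •
          M.commProd (Fin.contractNth j.castSucc (· * ·) (Fin.tail a)))) := by
      intro j
      rw [← Fin.succ_castSucc, contractNth_succ_eq_cons, commProd_succ, Fin.cons_zero,
        Fin.tail_cons, Fin.val_succ, pow_succ', mul_smul, neg_one_smul, mul_smul_comm]
    rw [Finset.sum_congr rfl fun j _ => h1 j, Finset.sum_neg_distrib, ← Finset.mul_sum, ih]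
    simp only [Fin.val_zero, pow_zero, one_smul, Fin.castSucc_zero, contractNth_zero_eq_cons]
    -- Of the two Leibniz terms of `[F, a₀ a₁]`, the one containing `[F, a₀] a₁` cancels the left
    -- end of the shorter sum; the other becomes the new left end.
    rw [commProd_succ, Fin.cons_zero, Fin.tail_cons, comm_mul, M.commProd_succ (Fin.tail a),
      M.commProd_succ (Fin.init a)]
    have e1 : Fin.tail a 0 = a 1 := rfl
    have e2 : Fin.init a 0 = a 0 := rfl
    have e3 : Fin.tail a (Fin.last (k + 1)) = a (Fin.last (k + 2)) := rfl
    have e4 : Fin.tail (Fin.init a) = Fin.init (Fin.tail a) := rfl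
    rw [e1, e2, e3, e4, pow_succ', mul_smul, neg_one_smul, mul_add, mul_smul_comm]
    noncomm_ring

/-- The properties that the grading of an even module (for even `n`) and the unit (for odd `n`)
have in common. -/
structure IsGrading (γ : H →L[ℂ] H) (n : ℕ) : Prop where
  mem : γ ∈ M.N
  mul_ρ : ∀ a, γ * M.ρ a = M.ρ a * γ
  mul_F : γ * M.F = (-1 : ℂ) ^ (n + 1) • (M.F * γ)

variable {M} {γ : H →L[ℂ] H} {n : ℕ}

theorem neg_one_pow_mul_self (n : ℕ) : (-1 : ℂ) ^ n * (-1) ^ n = 1 := by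
  rw [← mul_pow]; simp

theorem IsGrading.mul_comm (hγ : M.IsGrading γ n) (a : A) :
    γ * M.comm a = (-1 : ℂ) ^ (n + 1) • (M.comm a * γ) := by
  rw [comm, mul_sub, ← mul_assoc, ← mul_assoc, hγ.mul_F, hγ.mul_ρ, smul_mul_assoc, mul_assoc,
    hγ.mul_ρ, mul_assoc, hγ.mul_F, mul_smul_comm, ← smul_sub, sub_mul, mul_assoc, mul_assoc]

theorem IsGrading.comm_mul_F (hγ : M.IsGrading γ n) (a : A) :
    M.comm a * (γ * M.F) = (-1 : ℂ) ^ n • (γ * M.F * M.comm a) := by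
  rw [mul_assoc γ, F_mul_comm, mul_neg, ← mul_assoc γ, hγ.mul_comm, smul_mul_assoc, pow_succ',
    mul_smul, neg_one_smul, neg_neg, smul_smul, neg_one_pow_mul_self, one_smul, mul_assoc]

theorem IsGrading.F_mul_mul_F (hγ : M.IsGrading γ n) :
    M.F * γ * M.F = (-1 : ℂ) ^ (n + 1) • γ := by
  rw [mul_assoc, hγ.mul_F, mul_smul_comm, ← mul_assoc, M.F_sq, one_mul]

open SemifiniteTrace

/-- Ordinary cyclicity brings `[F, a]` to the front; passing it through `γ F` costs `(-1)^{n+1}`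
from `γ` and `-1` from `F`. -/
theorem IsGrading.trace_mul_comm (hγ : M.IsGrading γ n) {X : H →L[ℂ] H}
    (hX : M.τ.IsTraceClass X) (a : A) :
    M.τ.trace (γ * M.F * (X * M.comm a)) =
      (-1) ^ n * M.τ.trace (γ * M.F * (M.comm a * X)) := by
  have hN := mul_mem hγ.mem M.F_mem
  have h := SemifiniteTrace.trace_mul_comm (hX.mul_left hN) (M.comm_mem a)
  have e : M.comm a * (γ * M.F * X) = (-1 : ℂ) ^ n • (γ * M.F * (M.comm a * X)) := by
    rw [← mul_assoc, hγ.comm_mul_F, smul_mul_assoc, mul_assoc (γ * M.F)]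
  rw [e, trace_smul _ ((hX.mul_left (M.comm_mem a)).mul_left hN), mul_assoc (γ * M.F) X] at h
  exact h.symm

/-- Conjugation by `F` preserves the trace and, for `k` of the parity of `n`, reverses the sign of
this operator. -/
theorem IsGrading.trace_eq_zero (hγ : M.IsGrading γ n) {k : ℕ} (a : Fin k → A)
    (ha : M.τ.IsTraceClass (M.commProd a)) (hk : (-1 : ℂ) ^ k = (-1) ^ n) :
    M.τ.trace (γ * M.commProd a) = 0 := by
  have h1 := SemifiniteTrace.trace_mul_comm ((ha.mul_left hγ.mem).mul_right M.F_mem) M.F_mem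
  have e1 : M.F * (γ * M.commProd a * M.F) = -(γ * M.commProd a) := by
    have h2 : M.commProd a * M.F = (-1 : ℂ) ^ k • (M.F * M.commProd a) := by
      rw [F_mul_commProd, smul_smul, neg_one_pow_mul_self, one_smul]
    rw [mul_assoc, h2, mul_smul_comm, mul_smul_comm, ← mul_assoc, ← mul_assoc, hγ.F_mul_mul_F,
      smul_mul_assoc, smul_smul, hk, pow_succ', mul_left_comm, neg_one_pow_mul_self, mul_one,
      neg_one_smul]
  have e2 : γ * M.commProd a * M.F * M.F = γ * M.commProd a := by
    rw [mul_assoc, M.F_sq, mul_one]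
  rw [e1, e2, trace_neg (ha.mul_left hγ.mem)] at h1
  linear_combination (-1 / 2 : ℂ) * h1

/-- Write `F [F, a₀] = a₀ - F a₀ F`. Moving the right-hand `F` through the `k` commutators and
around the trace shows that the second term contributes as much as the first. -/
theorem IsGrading.trace_F_mul (hγ : M.IsGrading γ n) {k : ℕ} (a : Fin (k + 1) → A)
    (ha : M.τ.IsTraceClass (M.commProd (Fin.tail a))) (hk : (-1 : ℂ) ^ k = (-1) ^ n) :
    M.τ.trace (γ * M.F * M.commProd a) =
      2 * M.τ.trace (γ * M.ρ (a 0) * M.commProd (Fin.tail a)) := by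
  set X := M.commProd (Fin.tail a) with hX
  have hγN := hγ.mem
  have hFN := M.F_mem
  have hρN := M.ρ_mem (a 0)
  have e : γ * M.F * M.commProd a =
      γ * M.ρ (a 0) * X - γ * M.F * M.ρ (a 0) * (M.F * X) := by
    rw [commProd_succ, ← hX, comm]
    have : M.F * (M.F * (M.ρ (a 0) * X)) = M.ρ (a 0) * X := by
      rw [← mul_assoc, M.F_sq, one_mul]
    simp only [mul_sub, sub_mul, mul_assoc, this]
  have t1 : M.τ.IsTraceClass (γ * M.ρ (a 0) * X) := ha.mul_left (mul_mem hγN hρN)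
  have t2 : M.τ.IsTraceClass (γ * M.F * M.ρ (a 0) * X) :=
    ha.mul_left (mul_mem (mul_mem hγN hFN) hρN)
  have t3 : M.τ.IsTraceClass (γ * M.F * M.ρ (a 0) * (M.F * X)) :=
    (ha.mul_left hFN).mul_left (mul_mem (mul_mem hγN hFN) hρN)
  have e2 : M.τ.trace (γ * M.F * M.ρ (a 0) * (M.F * X)) =
      -M.τ.trace (γ * M.ρ (a 0) * X) := by
    have h1 := SemifiniteTrace.trace_mul_comm t2 hFN
    have e3 : M.F * (γ * M.F * M.ρ (a 0) * X) =
        (-1 : ℂ) ^ (n + 1) • (γ * M.ρ (a 0) * X) := by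
      rw [← mul_assoc, ← mul_assoc, ← mul_assoc, hγ.F_mul_mul_F, smul_mul_assoc, smul_mul_assoc]
    rw [e3, trace_smul _ t1] at h1
    rw [hX, F_mul_commProd, ← hX, mul_smul_comm, ← mul_assoc, trace_smul _ (t2.mul_right hFN),
      ← h1, hk, pow_succ']
    linear_combination (-M.τ.trace (γ * M.ρ (a 0) * X)) * neg_one_pow_mul_self n
  rw [e, trace_sub t1 t3, e2]
  ring

theorem connesB_chWith : connesB (M.chWith γ n) = 0 := by
  funext k a
  by_cases hk : k + 1 = n
  swap
  · simp [connesB, chWith, Pi.single_eq_of_ne hk]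
  subst hk
  simp only [connesB, chWith, Pi.single_eq_same, Pi.zero_apply]
  refine Finset.sum_eq_zero fun j _ => ?_
  rw [chOp, M.commProd_eq_zero _ 0 (Fin.cons_zero _ _), mul_zero, trace_zero, mul_zero, mul_zero]

section Summable

variable [CompleteSpace A] {p : ℝ}

/-- One rotation step uses twisted cyclicity with `X` a product of only `n` commutators, which is
trace class because `n > p`. -/
theorem IsGrading.trace_chOp_rotate (hγ : M.IsGrading γ n) (hp : 0 < p) (h : M.IsPSummable p)
    (hn : p < n) (a : Fin (n + 1) → A) (j : ℕ) :
    M.τ.trace (M.chOp γ fun i => a (i + Fin.ofNat (n + 1) j)) =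
      (-1) ^ (n * j) * M.τ.trace (M.chOp γ a) := by
  have step : ∀ a : Fin (n + 1) → A, M.τ.trace (M.chOp γ fun i => a (i + 1)) =
      (-1) ^ n * M.τ.trace (M.chOp γ a) := by
    intro a
    have e1 : (Fin.init fun i : Fin (n + 1) => a (i + 1)) = Fin.tail a := by
      funext i
      simp [Fin.init, Fin.tail]
    rw [chOp, chOp, commProd_succ_last, commProd_succ, e1, Fin.last_add_one,
      hγ.trace_mul_comm (h.isTraceClass_commProd hp hn _)]
  induction j with
  | zero => simp
  | succ j ih =>
    have e : (fun i => a (i + Fin.ofNat (n + 1) (j + 1))) =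
        fun i => (fun i => a (i + Fin.ofNat (n + 1) j)) (i + 1) := by
      funext i
      congr 1
      apply Fin.ext
      simp only [Fin.val_add, Fin.val_one', Fin.ofNat, Nat.add_mod_mod,
        Nat.mod_add_mod]
      congr 1
      ring
    rw [e]
    refine (step fun i => a (i + Fin.ofNat (n + 1) j)).trans ?_
    rw [ih, mul_add, mul_one, pow_add]
    ring

/-- After telescoping, two end terms remain. Leibniz for `[F, e a₀]` splits the wrap-around term in
two: one part cancels an end by twisted cyclicity, the other by `hzero`. -/
theorem IsGrading.hochschild_chWith (hγ : M.IsGrading γ n) (hp : 0 < p) (h : M.IsPSummable p)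
    (hn : p < n) : hochschild (M.chWith γ n) = 0 := by
  funext k a
  rcases k with _ | k
  · rfl
  by_cases hk : k = n
  swap
  · simp [hochschild, chWith, Pi.single_eq_of_ne hk]
  subst hk
  simp only [hochschild, chWith, Pi.single_eq_same, Pi.zero_apply]
  set c : ℂ := ((Real.Gamma ((k : ℝ) / 2 + 1) / (2 * (k.factorial : ℝ)) : ℝ) : ℂ)
  have hFN := mul_mem hγ.mem M.F_mem
  set m : Fin k → A := Fin.tail (Fin.init a) with hm
  set X := M.commProd m with hX
  have tX : M.τ.IsTraceClass X := h.isTraceClass_commProd hp hn m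
  set e := a (Fin.last (k + 1)) with he
  have htail : M.commProd (Fin.tail a) = X * M.comm e := M.commProd_succ_last (Fin.tail a)
  have hinit : M.commProd (Fin.init a) = M.comm (a 0) * X := M.commProd_succ (Fin.init a)
  have hsum : ∑ j : Fin (k + 1), (-1 : ℂ) ^ (j : ℕ) *
      M.τ.trace (M.chOp γ (Fin.contractNth j.castSucc (· * ·) a)) =
      M.τ.trace (γ * M.F * (M.ρ (a 0) * X * M.comm e)) +
        (-1) ^ k * M.τ.trace (γ * M.F * (M.comm (a 0) * X) * M.ρ e) := by
    -- The trace is additive only on trace class operators, so the induction carries membership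
    -- along with the identity.
    have h1 : ∀ s : Finset (Fin (k + 1)), ∑ j ∈ s, (-1 : ℂ) ^ (j : ℕ) *
        M.τ.trace (M.chOp γ (Fin.contractNth j.castSucc (· * ·) a)) =
        M.τ.trace (γ * M.F * ∑ j ∈ s, (-1 : ℂ) ^ (j : ℕ) •
          M.commProd (Fin.contractNth j.castSucc (· * ·) a)) ∧
        M.τ.IsTraceClass (∑ j ∈ s, (-1 : ℂ) ^ (j : ℕ) •
          M.commProd (Fin.contractNth j.castSucc (· * ·) a)) := by
      intro s
      induction s using Finset.cons_induction with
      | empty => exact ⟨by simp [trace_zero], ⟨0, TraceBound.zero⟩⟩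
      | cons j s hj ih =>
        have t1 : M.τ.IsTraceClass ((-1 : ℂ) ^ (j : ℕ) •
            M.commProd (Fin.contractNth j.castSucc (· * ·) a)) :=
          (h.isTraceClass_commProd hp (hn.trans (by simp)) _).smul _
        rw [Finset.sum_cons, Finset.sum_cons, ih.1, mul_add,
          trace_add (t1.mul_left hFN) (ih.2.mul_left hFN), mul_smul_comm,
          trace_smul _ ((h.isTraceClass_commProd hp (hn.trans (by simp)) _).mul_left hFN)]
        exact ⟨rfl, t1.add ih.2⟩
    have tA : M.τ.IsTraceClass (M.ρ (a 0) * (X * M.comm e)) :=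
      (tX.mul_right (M.comm_mem e)).mul_left (M.ρ_mem _)
    have tB : M.τ.IsTraceClass (M.comm (a 0) * X * M.ρ e) :=
      (tX.mul_left (M.comm_mem _)).mul_right (M.ρ_mem e)
    rw [(h1 _).1, sum_commProd_contractNth, htail, hinit, mul_add, mul_smul_comm,
      trace_add (tA.mul_left hFN) ((tB.mul_left hFN).smul _), trace_smul _ (tB.mul_left hFN)]
    simp only [mul_assoc]
  have hlast : M.τ.trace (M.chOp γ (Function.update (Fin.init a) 0 (e * a 0))) =
      (-1) ^ k * M.τ.trace (γ * M.F * (M.ρ (a 0) * X * M.comm e)) +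
        M.τ.trace (γ * M.F * M.ρ e * (M.comm (a 0) * X)) := by
    have e1 : Fin.tail (Function.update (Fin.init a) 0 (e * a 0)) = m := by
      rw [Fin.tail_update_zero]
    have t1 : M.τ.IsTraceClass (M.comm e * (M.ρ (a 0) * X)) :=
      (tX.mul_left (M.ρ_mem _)).mul_left (M.comm_mem _)
    have t2 : M.τ.IsTraceClass (M.ρ e * (M.comm (a 0) * X)) :=
      (tX.mul_left (M.comm_mem _)).mul_left (M.ρ_mem _)
    rw [chOp, commProd_succ, Function.update_self, e1, comm_mul, add_mul, mul_assoc (M.comm e),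
      mul_assoc (M.ρ e), mul_add, trace_add (t1.mul_left hFN) (t2.mul_left hFN),
      hγ.trace_mul_comm (tX.mul_left (M.ρ_mem (a 0))), ← mul_assoc ((-1 : ℂ) ^ k),
      neg_one_pow_mul_self, one_mul, mul_assoc (γ * M.F)]
  have hzero : M.τ.trace (γ * M.F * (M.comm (a 0) * X) * M.ρ e) =
      M.τ.trace (γ * M.F * M.ρ e * (M.comm (a 0) * X)) := by
    set Y := M.comm (a 0) * X with hY
    have tY : M.τ.IsTraceClass Y := tX.mul_left (M.comm_mem _)
    rw [← SemifiniteTrace.trace_mul_comm (tY.mul_left hFN) (M.ρ_mem e), ← sub_eq_zero,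
      ← trace_sub ((tY.mul_left hFN).mul_left (M.ρ_mem e))
        (tY.mul_left (mul_mem hFN (M.ρ_mem e)))]
    -- The discrepancy is `-γ [F, e] Y`, a product of `k + 2` commutators; this has the parity for
    -- which `trace_eq_zero` applies.
    have e1 : M.ρ e * (γ * M.F * Y) - γ * M.F * M.ρ e * Y = -(γ * M.commProd (Fin.cons e
        (Fin.init a) : Fin (k + 2) → A)) := by
      have e2 : M.ρ e * (γ * M.F * Y) = γ * M.ρ e * M.F * Y := by
        rw [hγ.mul_ρ]
        simp only [mul_assoc]
      rw [commProd_succ, Fin.cons_zero, Fin.tail_cons, hinit, e2, comm]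
      clear_value Y
      noncomm_ring
    have t1 : M.τ.IsTraceClass (M.commProd (Fin.cons e (Fin.init a) : Fin (k + 2) → A)) :=
      h.isTraceClass_commProd hp (by push_cast; linarith) _
    rw [e1, trace_neg (t1.mul_left hγ.mem), hγ.trace_eq_zero _ t1 (by ring), neg_zero]
  simp only [mul_left_comm _ c]
  rw [← Finset.mul_sum, ← mul_add, hsum, hlast, hzero, pow_succ]
  linear_combination (-c * M.τ.trace (γ * M.F * (M.ρ (a 0) * X * M.comm e))) *
    neg_one_pow_mul_self k

/-- The factor `n + 1` is the number of rotations summed by `B`; the normalization of the characters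
is chosen to absorb it. -/
theorem gamma_factorial (n : ℕ) :
    Real.Gamma ((n : ℝ) / 2 + 2) / ((n + 2).factorial : ℝ) * (n + 1) =
      Real.Gamma ((n : ℝ) / 2 + 1) / (2 * (n.factorial : ℝ)) := by
  have h1 : (n : ℝ) / 2 + 2 = ((n : ℝ) / 2 + 1) + 1 := by ring
  have h2 : (n : ℝ) / 2 + 1 ≠ 0 := by positivity
  have h3 : (n.factorial : ℝ) ≠ 0 := by positivity
  rw [h1, Real.Gamma_add_one h2, Nat.factorial_succ, Nat.factorial_succ]
  push_cast
  field_simp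
  ring

/-- The leading `1` turns `ψ` into a rotated `ch`-trace. The rotation sign cancels the sign in `B`,
which leaves `n + 1` equal terms. -/
theorem IsGrading.connesB_psiWith (hγ : M.IsGrading γ n) (hp : 0 < p) (h : M.IsPSummable p)
    (hn : p < n) : connesB (M.psiWith γ n) = M.chWith γ n := by
  funext k a
  by_cases hk : k = n
  swap
  · rw [chWith, Pi.single_eq_of_ne hk]
    have hk' : k + 1 ≠ n + 1 := by simpa using hk
    simp [connesB, psiWith, Pi.single_eq_of_ne hk']
  subst hk
  simp only [connesB, psiWith, chWith, Pi.single_eq_same]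
  have e : ∀ j : Fin (k + 1), M.τ.trace (M.psiOp γ (Fin.cons (1 : A) fun i => a (i + j) :
      Fin (k + 2) → A)) = (-1) ^ (k * (j : ℕ)) * M.τ.trace (M.chOp γ a) := by
    intro j
    rw [← hγ.trace_chOp_rotate hp h hn a j, Fin.ofNat_val_eq_self, psiOp, chOp, Fin.cons_zero,
      Fin.tail_cons, map_one, mul_one]
  have e2 : ∀ (c : ℂ) (j : ℕ), (-1 : ℂ) ^ (k * j) * (c * ((-1) ^ (k * j) *
      M.τ.trace (M.chOp γ a))) = c * M.τ.trace (M.chOp γ a) := by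
    intro c j
    linear_combination (c * M.τ.trace (M.chOp γ a)) * neg_one_pow_mul_self (k * j)
  simp only [e, e2, Finset.sum_const, Finset.card_univ, Fintype.card_fin, nsmul_eq_mul]
  rw [← gamma_factorial k]
  push_cast
  ring

/-- Telescoping on `a₁, …, a_{n+2}` leaves a right end that cancels the wrap-around term, and a left
end that differs from the contraction of `a₀ a₁` by the commutator `[F, a₁]`. -/
theorem IsGrading.hochschild_psiWith (hγ : M.IsGrading γ n) (hp : 0 < p) (h : M.IsPSummable p)
    (hn : p < n) : hochschild (M.psiWith γ n) = -M.chWith γ (n + 2) := by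
  funext k a
  rcases k with _ | k
  · rw [Pi.neg_apply, chWith, Pi.single_eq_of_ne (by simp)]
    simp [hochschild]
  by_cases hk : k = n + 1
  swap
  · have hk' : k + 1 ≠ n + 2 := by simpa using hk
    rw [Pi.neg_apply, chWith, Pi.single_eq_of_ne hk']
    simp [hochschild, psiWith, Pi.single_eq_of_ne hk]
  subst hk
  simp only [hochschild, psiWith, chWith, Pi.single_eq_same, Pi.neg_apply]
  have hγN := hγ.mem
  have hn1 : p < ((n + 1 : ℕ) : ℝ) := hn.trans (by simp)
  have hn2 : p < ((n + 2 : ℕ) : ℝ) := hn.trans (by simp)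
  have hG : (((n + 2 : ℕ) : ℝ) / 2 + 1) = (n : ℝ) / 2 + 2 := by push_cast; ring
  rw [hG]
  set e := a (Fin.last (n + 2)) with he
  set Y := M.commProd (Fin.tail (Fin.init a)) with hY
  have tY : M.τ.IsTraceClass Y := h.isTraceClass_commProd hp hn1 _
  have hsucc : ∀ j : Fin (n + 1), M.psiOp γ (Fin.contractNth j.succ.castSucc (· * ·) a) =
      γ * M.ρ (a 0) * M.F * M.commProd (Fin.contractNth j.castSucc (· * ·) (Fin.tail a)) := by
    intro j
    rw [← Fin.succ_castSucc, contractNth_succ_eq_cons, psiOp, Fin.cons_zero, Fin.tail_cons]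
  have hS : γ * M.ρ (a 0) * M.F ∈ M.N := mul_mem (mul_mem hγN (M.ρ_mem _)) M.F_mem
  have tZ : ∀ b : Fin (n + 1) → A, M.τ.IsTraceClass (M.commProd b) :=
    fun b => h.isTraceClass_commProd hp hn1 b
  have hsum : ∑ j : Fin (n + 1), (-1 : ℂ) ^ (j : ℕ) * M.τ.trace (γ * M.ρ (a 0) * M.F *
      M.commProd (Fin.contractNth j.castSucc (· * ·) (Fin.tail a))) =
      M.τ.trace (γ * M.ρ (a 0) * M.F * (M.ρ (a 1) * M.commProd (Fin.tail (Fin.tail a)))) +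
        (-1) ^ n * M.τ.trace (γ * M.ρ (a 0) * M.F * (Y * M.ρ e)) := by
    have h1 : ∀ s : Finset (Fin (n + 1)), ∑ j ∈ s, (-1 : ℂ) ^ (j : ℕ) *
        M.τ.trace (γ * M.ρ (a 0) * M.F *
          M.commProd (Fin.contractNth j.castSucc (· * ·) (Fin.tail a))) =
        M.τ.trace (γ * M.ρ (a 0) * M.F * ∑ j ∈ s, (-1 : ℂ) ^ (j : ℕ) •
          M.commProd (Fin.contractNth j.castSucc (· * ·) (Fin.tail a))) ∧
        M.τ.IsTraceClass (∑ j ∈ s, (-1 : ℂ) ^ (j : ℕ) •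
          M.commProd (Fin.contractNth j.castSucc (· * ·) (Fin.tail a))) := by
      intro s
      induction s using Finset.cons_induction with
      | empty => exact ⟨by simp [trace_zero], ⟨0, TraceBound.zero⟩⟩
      | cons j s hj ih =>
        have t1 := tZ (Fin.contractNth j.castSucc (· * ·) (Fin.tail a))
        rw [Finset.sum_cons, Finset.sum_cons, ih.1, mul_add,
          trace_add ((t1.smul _).mul_left hS) (ih.2.mul_left hS), mul_smul_comm,
          trace_smul _ (t1.mul_left hS)]
        exact ⟨rfl, (t1.smul _).add ih.2⟩
    have tA := (tZ (Fin.tail (Fin.tail a))).mul_left (M.ρ_mem (a 1))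
    have tB := tY.mul_right (M.ρ_mem e)
    rw [(h1 _).1, sum_commProd_contractNth]
    change M.τ.trace (_ * (M.ρ (a 1) * _ + (-1 : ℂ) ^ n • (Y * M.ρ e))) = _
    rw [mul_add, mul_smul_comm, trace_add (tA.mul_left hS) ((tB.mul_left hS).smul _),
      trace_smul _ (tB.mul_left hS)]
  have hzero : M.psiOp γ (Fin.contractNth (Fin.castSucc 0) (· * ·) a) =
      γ * M.ρ (a 0) * M.ρ (a 1) * M.F * M.commProd (Fin.tail (Fin.tail a)) := by
    rw [Fin.castSucc_zero, contractNth_zero_eq_cons, psiOp, Fin.cons_zero, Fin.tail_cons, map_mul]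
    simp only [mul_assoc]
  have hlast : M.τ.trace (M.psiOp γ (Function.update (Fin.init a) 0 (e * a 0))) =
      M.τ.trace (γ * M.ρ (a 0) * M.F * (Y * M.ρ e)) := by
    have e1 : Fin.tail (Function.update (Fin.init a) 0 (e * a 0)) = Fin.tail (Fin.init a) := by
      rw [Fin.tail_update_zero]
    rw [psiOp, Function.update_self, e1, ← hY, map_mul, ← mul_assoc γ, hγ.mul_ρ,
      ← mul_assoc _ Y, ← SemifiniteTrace.trace_mul_comm (tY.mul_left hS) (M.ρ_mem e)]
    simp only [mul_assoc]
  have hW : M.commProd (Fin.tail a) = M.comm (a 1) * M.commProd (Fin.tail (Fin.tail a)) :=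
    M.commProd_succ (Fin.tail a)
  have tW : M.τ.IsTraceClass (M.commProd (Fin.tail a)) := h.isTraceClass_commProd hp hn2 _
  have tU := tZ (Fin.tail (Fin.tail a))
  have hmain : M.τ.trace (γ * M.ρ (a 0) * M.ρ (a 1) * M.F * M.commProd (Fin.tail (Fin.tail a))) -
      M.τ.trace (γ * M.ρ (a 0) * M.F * (M.ρ (a 1) * M.commProd (Fin.tail (Fin.tail a)))) =
      -M.τ.trace (γ * M.ρ (a 0) * M.commProd (Fin.tail a)) := by
    rw [← trace_neg (tW.mul_left (mul_mem hγN (M.ρ_mem _))),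
      ← trace_sub (tU.mul_left (mul_mem (mul_mem (mul_mem hγN (M.ρ_mem _)) (M.ρ_mem _)) M.F_mem))
        ((tU.mul_left (M.ρ_mem _)).mul_left hS), hW, comm]
    congr 1
    noncomm_ring
  -- The factor `2` gained here cancels the `2` in the denominator of the normalization of
  -- `ch^{n+2}`.
  have hch := hγ.trace_F_mul a tW (by ring)
  rw [Fin.sum_univ_succ]
  simp only [hsucc, hzero, Fin.val_zero, pow_zero, one_mul, Fin.val_succ, pow_succ]
  rw [hlast, chOp, hch]
  have hs : ∀ c : ℂ, ∑ j : Fin (n + 1), (-1 : ℂ) ^ (j : ℕ) * -1 * (c * M.τ.trace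
      (γ * M.ρ (a 0) * M.F * M.commProd (Fin.contractNth j.castSucc (· * ·) (Fin.tail a)))) =
      -c * ∑ j : Fin (n + 1), (-1 : ℂ) ^ (j : ℕ) * M.τ.trace
      (γ * M.ρ (a 0) * M.F * M.commProd (Fin.contractNth j.castSucc (· * ·) (Fin.tail a))) := by
    intro c
    rw [Finset.mul_sum]
    exact Finset.sum_congr rfl fun j _ => by ring
  rw [hs, hsum]
  push_cast
  linear_combination ((Real.Gamma ((n : ℝ) / 2 + 2) : ℂ) / ((n + 2).factorial : ℂ)) * hmain

theorem IsGrading.bB_chWith (hγ : M.IsGrading γ n) (hp : 0 < p) (h : M.IsPSummable p)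
    (hn : p < n) : bB A (M.chWith γ n) = 0 := by
  change hochschild _ + connesB _ = 0
  rw [hγ.hochschild_chWith hp h hn, connesB_chWith, add_zero]

theorem IsGrading.bB_psiWith (hγ : M.IsGrading γ n) (hp : 0 < p) (h : M.IsPSummable p)
    (hn : p < n) : M.chWith γ n - M.chWith γ (n + 2) = bB A (M.psiWith γ n) := by
  change _ = hochschild _ + connesB _
  rw [hγ.hochschild_psiWith hp h hn, hγ.connesB_psiWith hp h hn]
  abel

/-- The Connes character theorem for all exponents `n > p` of the parity `ε`. -/
theorem connes_character (hp : 0 < p) (h : M.IsPSummable p) (ε : ZMod 2) (γ : H →L[ℂ] H)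
    (hγ : ∀ n : ℕ, (n : ZMod 2) = ε → M.IsGrading γ n) :
    (∀ n : ℕ, (n : ZMod 2) = ε → p < n →
      (∀ a : Fin (n + 1) → A, M.τ.IsSummable 1 (M.chOp γ a)) ∧
      (∀ a : Fin (n + 2) → A, M.τ.IsSummable 1 (M.psiOp γ a))) ∧
    (∃ c : HE A ε, ∀ n : ℕ, (n : ZMod 2) = ε → p < n →
      ∃ h : M.chWith γ n ∈ entireCocycles A ε, HE.mk (M.chWith γ n) h = c) ∧
    (∀ n : ℕ, (n : ZMod 2) = ε → p < n →
      M.psiWith γ n ∈ entireCochains A (ε + 1) ∧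
      M.chWith γ n - M.chWith γ (n + 2) = bB A (M.psiWith γ n)) := by
  have hcoc : ∀ n : ℕ, (n : ZMod 2) = ε → p < n → M.chWith γ n ∈ entireCocycles A ε :=
    fun n hε hn => ⟨h.chWith_mem hp hn (hγ n hε).mem hε, (hγ n hε).bB_chWith hp h hn⟩
  have hpsi : ∀ n : ℕ, (n : ZMod 2) = ε → p < n → M.psiWith γ n ∈ entireCochains A (ε + 1) :=
    fun n hε hn => h.psiWith_mem hp hn (hγ n hε).mem (by push_cast; rw [hε])
  refine ⟨fun n hε hn => ⟨fun a => ?_, fun a => ?_⟩, ?_, fun n hε hn =>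
    ⟨hpsi n hε hn, (hγ n hε).bB_psiWith hp h hn⟩⟩
  · obtain ⟨C, hC⟩ := h.isTraceClass_chOp hp hn (hγ n hε).mem a
    exact hC.isSummable_one
  · obtain ⟨C, hC⟩ := h.isTraceClass_psiOp hp hn (hγ n hε).mem a
    exact hC.isSummable_one
  · have hstep : ∀ (j n : ℕ) (hε : (n : ZMod 2) = ε) (hn : p < n)
        (hε' : ((n + 2 * j : ℕ) : ZMod 2) = ε) (hn' : p < ((n + 2 * j : ℕ) : ℝ)),
        HE.mk _ (hcoc (n + 2 * j) hε' hn') = HE.mk _ (hcoc n hε hn) := by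
      intro j
      induction j with
      | zero => intro n hε hn hε' hn'; rfl
      | succ j ih =>
        intro n hε hn hε' hn'
        have hn2 : p < ((n + 2 * j : ℕ) : ℝ) := by push_cast; linarith [(j.cast_nonneg : (0 : ℝ) ≤ j)]
        have hε2 : ((n + 2 * j : ℕ) : ZMod 2) = ε := by
          have h2 : (2 : ZMod 2) = 0 := rfl
          push_cast
          rw [hε, h2, zero_mul, add_zero]
        rw [← ih n hε hn hε2 hn2]
        refine Eq.symm ((Submodule.Quotient.eq _).2 ?_)
        exact ⟨M.psiWith γ (n + 2 * j), hpsi _ hε2 hn2, ((hγ _ hε2).bB_psiWith hp h hn2).symm⟩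
    have hex : ∃ n : ℕ, (n : ZMod 2) = ε ∧ p < n := by
      obtain ⟨m, hm⟩ := exists_nat_gt p
      refine ⟨2 * m + ε.val, ?_, ?_⟩
      · have h2 : (2 : ZMod 2) = 0 := rfl
        push_cast
        rw [ZMod.natCast_zmod_val, h2, zero_mul, zero_add]
      · push_cast
        have : (0 : ℝ) ≤ ε.val := Nat.cast_nonneg _
        linarith
    classical
    -- The common class is that of the least admissible degree; any other admissible degree exceeds
    -- it by an even number and is reached by repeated transgression.
    obtain ⟨hε₀, hn₀⟩ := Nat.find_spec hex
    refine ⟨HE.mk _ (hcoc _ hε₀ hn₀), fun n hε hn => ⟨hcoc n hε hn, ?_⟩⟩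
    have hle : Nat.find hex ≤ n := Nat.find_min' hex ⟨hε, hn⟩
    have hmod : Nat.find hex ≡ n [MOD 2] := (ZMod.natCast_eq_natCast_iff _ _ _).1 (hε₀.trans hε.symm)
    obtain ⟨j, hj⟩ := (Nat.modEq_iff_dvd' hle).1 hmod
    obtain rfl : n = Nat.find hex + 2 * j := by omega
    exact hstep j _ hε₀ hn₀ hε hn

end Summable

theorem isGrading_one (M : OddModule A H) {n : ℕ} (hn : Odd n) : M.IsGrading 1 n where
  mem := one_mem M.N
  mul_ρ a := by rw [one_mul, mul_one]
  mul_F := by rw [hn.add_one.neg_one_pow, one_smul, one_mul, mul_one]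

end OddModule

theorem EvenModule.isGrading [StarRing A] (M : EvenModule A H) {n : ℕ} (hn : Even n) :
    M.toOddModule.IsGrading M.χ n where
  mem := M.χ_mem
  mul_ρ := M.χ_even
  mul_F := by rw [hn.add_one.neg_one_pow, neg_one_smul, M.χ_odd]

end BreuerFredholm

end

theorem theorem1p3 {A : Type*} [NormedRing A] [NormedAlgebra ℂ A] [CompleteSpace A] [StarRing A]
    [StarModule ℂ A] {H : Type*} [NormedAddCommGroup H] [InnerProductSpace ℂ H] [CompleteSpace H]
    (p : ℝ) (hp : 0 < p) :
    (∀ M : BreuerFredholm.EvenModule A H, M.IsPSummable p →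
      -- all the traces in the formulas exist
      (∀ n : ℕ, Even n → p < n →
        (∀ a : Fin (n + 1) → A, M.τ.IsSummable 1 (M.chOp M.χ a)) ∧
        (∀ a : Fin (n + 2) → A, M.τ.IsSummable 1 (M.psiOp M.χ a))) ∧
      -- the even characters are entire cyclic cocycles, all of the same class in `HE^+(A)`
      (∃ c : BreuerFredholm.HE A 0, ∀ n : ℕ, Even n → p < n →
        ∃ h : M.ch n ∈ BreuerFredholm.entireCocycles A 0, BreuerFredholm.HE.mk (M.ch n) h = c) ∧
      -- transgression by an entire cochain
      (∀ n : ℕ, Even n → p < n →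
        M.psi n ∈ BreuerFredholm.entireCochains A 1 ∧
        M.ch n - M.ch (n + 2) = BreuerFredholm.bB A (M.psi n))) ∧
    (∀ M : BreuerFredholm.OddModule A H, M.IsPSummable p →
      -- all the traces in the formulas exist
      (∀ n : ℕ, Odd n → p < n →
        (∀ a : Fin (n + 1) → A, M.τ.IsSummable 1 (M.chOp 1 a)) ∧
        (∀ a : Fin (n + 2) → A, M.τ.IsSummable 1 (M.psiOp 1 a))) ∧
      -- the odd characters are entire cyclic cocycles, all of the same class in `HE^-(A)`
      (∃ c : BreuerFredholm.HE A 1, ∀ n : ℕ, Odd n → p < n →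
        ∃ h : M.ch n ∈ BreuerFredholm.entireCocycles A 1, BreuerFredholm.HE.mk (M.ch n) h = c) ∧
      -- transgression by an entire cochain
      (∀ n : ℕ, Odd n → p < n →
        M.psi n ∈ BreuerFredholm.entireCochains A 0 ∧
        M.ch n - M.ch (n + 2) = BreuerFredholm.bB A (M.psi n))) := by
  refine ⟨fun M h => ?_, fun M h => ?_⟩
  · simp only [← ZMod.natCast_eq_zero_iff_even]
    exact BreuerFredholm.OddModule.connes_character hp h 0 M.χ fun n hn =>
      M.isGrading (ZMod.natCast_eq_zero_iff_even.1 hn)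
  · simp only [← ZMod.natCast_eq_one_iff_odd]
    exact BreuerFredholm.OddModule.connes_character hp h 1 1 fun n hn =>
      M.isGrading_one (ZMod.natCast_eq_one_iff_odd.1 hn)
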